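/- **Setting.** Let $G=(V,E,w_G)$ be a finite directed graph with integral edge weights $w_G(e)\ge -W$, where $W>0$ is real, and let $n=|V|$. Let $G'$ be $G$ with all weights increased by $W/2$. For a graph $H$ with real weights $w_H$, let $H_{\ge 0}$ be $H$ with negative weights replaced by $0$, and for $\phi:V(H)\to\mathbb R$ let $H_\phi$ have weights $w_H(uv)+\phi(u)-\phi(v)$. Paths and cycles may be non-simple (a cycle is a closed walk with at least one edge). Put $n_H=|V(H)|$, $m_H=|E(H)|$; $\log$ is the natural logarithm. *Decompose.* A Decompose procedure with parameters $c,\kappa$ assigns to a subgraph $H$ of $G'$ and $d>0$ a random set $S_{(H,d)}\subseteq E(H)$ of positive-weight edges such that (progress) with probability at least $1-n^{-\kappa}$, each strongly connected component (SCC) $C$ of $H\setminus S_{(H,d)}$ has $|C|\le\frac34 n_H$, or every $v\in C$ has in- and out-ball of radius $d/4$ in $H_{\ge0}$ with more than $n_H/2$ vertices; and (sparse hitting) every path in $H$ of length at most $d$ in $H_{\ge 0}$ has in expectation at most $c\log n$ edges in $S_{(H,d)}$, with multiplicity. Different calls are independent. *Decomposition tree.* The root is $(G',d_0)$ with $d_0=nW/2$.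 A non-leaf node $(H,d)$ has as children the SCCs $C$ of $H\setminus S_{(H,d)}$, with parameter $d_C=d$ if $|C|\le\frac34 n_H$ and $d_C=d/2$ otherwise; the child is a leaf iff $d_C\le W/2$. Phase 1 stops the algorithm if some leaf contains an edge of negative weight in $G'$. Otherwise, in Phase 2, unless the algorithm has already stopped, BellmanFordDijkstra$(H,\phi)$ is called at the non-leaf node $(H,d)$ with some potential $\phi$ (which may depend on the random choices) for which all edges of $(H\setminus S_{(H,d)})_\phi$ are non-negative. *BellmanFordDijkstra$(H,\phi)$.* Add to $H$ a source $s$ with zero-weight edges to all vertices and $\phi(s)=0$, and run the Bellman-Ford/Dijkstra hybrid from $s$ with the weights reweighted by $\phi$: each iteration consists of a Dijkstra phase over non-negative edges, starting from the vertices whose distance has just changed, followed by one simultaneous relaxation of the negative edges leaving the vertices extracted in that phase. With the current path of each vertex its weight in $H_{\ge0}$ is recorded. The run terminates early at the end of a Dijkstra phase if some recorded path has $H_{\ge0}$-weight more than $d$. Time is counted as one unit per edge scan, vertex inspection or other elementary operation and $1+\lfloor\log_2\lfloor\log_2 (n_H+1)\rfloor\rfloor$ units per extraction of a minimum from the priority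 queue. Time and number of iterations are counted as $0$ if the call at $(H,d)$ is not made. **Lemma.** (a) For every $\kappa>0$ there is a $c$ such that random sets with the above guarantees exist for all finite directed graphs with real edge weights and all $d>0$ (with $n$ any integer that is at least the number of vertices). (b) For every $c$ there is a constant $C>0$ such that the following holds for all $G$, $W$, every Decompose procedure with parameters $c,\kappa$ ($\kappa$ arbitrary), and every non-leaf node $(H,d)$ such that $H$ contains a cycle of negative weight in $G'$. Condition on any possible outcome of all other calls to Decompose, so that only $S_{(H,d)}$ is random. Then: 1. The expected running time of BellmanFordDijkstra$(H,\phi)$ at the node is at most $C\,(m_H+n_H\log\log n_H)\log n$ (with $\log\log 1$ read as $0$), and its expected number of iterations is at most $C\log n$. 2. If $H$ has a negative-weight cycle all of whose edges have non-positive weight, then for every possible outcome of $S_{(H,d)}$ some leaf contains a negative edge, so that the algorithm stops in Phase 1 and the node is never processed. Moreover, if the progress property holds at all non-leaf nodes, then for every negative edge $uv$ in a leaf there is a path from $v$ to $u$ in $G'$, and $uv$ followed by any shortest path from $v$ to $u$ in $G'_{\ge0}$ is a negative-weight cycle of $G$. 3. Whenever BellmanFordDijkstra$(H,\phi)$ is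 called at the node, it terminates early, with a recorded path $P$ in $H$, from a vertex $u$ to a vertex $v$ say, of $H_{\ge0}$-weight more than $d$. If moreover $\phi\le0$ on $V(H)$ (as for potentials obtained from zero by lowering them and by taking distances), then $P$ has weight at most $0$ in $H$ and yields a negative-weight cycle of $G$: if $d<d_0$ and the progress property holds at all non-leaf nodes, then there is a path from $v$ to $u$ in $G'$, and $P$ followed by any shortest path from $v$ to $u$ in $G'_{\ge0}$ is a negative-weight cycle of $G$; if $d=d_0$, then $P$ itself contains a contiguous closed subwalk that is a negative-weight cycle both in $H$ and in $G$. -/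

import Mathlib

open scoped Classical

universe u

noncomputable section

/-! ### Finite directed graphs, walks, cycles -/

/-- A finite directed graph whose vertices are taken from `V`.  Edge weights are kept separately,
as functions `V → V → ℝ` of which only the values on edges matter. -/
structure FinDigraph (V : Type u) where
  verts : Finset V
  edges : Finset (V × V)
  fst_mem : ∀ e ∈ edges, e.1 ∈ verts
  snd_mem : ∀ e ∈ edges, e.2 ∈ verts

variable {V : Type u}

/-- The graph with edge set `E` on all of `V`. -/
def rootGraph [Fintype V] (E : Finset (V × V)) : FinDigraph V where
  verts := Finset.univ
  edges := E
  fst_mem := fun _ _ => Finset.mem_univ _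
  snd_mem := fun _ _ => Finset.mem_univ _

/-- The list of edges traversed by a list of vertices. -/
def walkEdges (P : List V) : List (V × V) := P.zip P.tail

/-- Total weight of a walk, edges counted with multiplicity. -/
def walkWeight (w : V → V → ℝ) (P : List V) : ℝ :=
  ((walkEdges P).map fun e => w e.1 e.2).sum

/-- A (potentially non-simple) path in `H`, as its nonempty list of vertices. -/
structure IsWalk (H : FinDigraph V) (P : List V) : Prop where
  ne_nil : P ≠ []
  verts_mem : ∀ v ∈ P, v ∈ H.verts
  edges_mem : ∀ e ∈ walkEdges P, e ∈ H.edges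

def IsWalkFromTo (H : FinDigraph V) (u v : V) (P : List V) : Prop :=
  IsWalk H P ∧ P.head? = some u ∧ P.getLast? = some v

def IsShortestWalk (H : FinDigraph V) (w : V → V → ℝ) (u v : V) (P : List V) : Prop :=
  IsWalkFromTo H u v P ∧ ∀ P', IsWalkFromTo H u v P' → walkWeight w P ≤ walkWeight w P'

/-- A cycle: a closed walk with at least one edge. -/
def IsCycle (H : FinDigraph V) (P : List V) : Prop :=
  IsWalk H P ∧ 2 ≤ P.length ∧ P.head? = P.getLast?

def IsNegCycle (H : FinDigraph V) (w : V → V → ℝ) (P : List V) : Prop :=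
  IsCycle H P ∧ walkWeight w P < 0

/-- The weights of `G_{≥0}`: negative weights are replaced by `0`. -/
def nonnegWt (w : V → V → ℝ) : V → V → ℝ := fun u v => max (w u v) 0

/-- The weights of `G_φ`. -/
def reweight (w : V → V → ℝ) (φ : V → ℝ) : V → V → ℝ := fun u v => w u v + φ u - φ v

/-- The weights of the scaled graph `G'`: every weight is increased by `W / 2`. -/
def scaledWt (wG : V → V → ℤ) (W : ℝ) : V → V → ℝ := fun u v => (wG u v : ℝ) + W / 2

/-! ### Strongly connected components and the guarantees of `Decompose` -/

/-- Reachability along the edges in `F`. -/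
def Reach (F : Finset (V × V)) (u v : V) : Prop :=
  Relation.ReflTransGen (fun a b => (a, b) ∈ F) u v

/-- The strongly connected component of `v` in `H ∖ S`, as a subgraph of `H ∖ S`. -/
def scc (H : FinDigraph V) (S : Finset (V × V)) (v : V) : FinDigraph V where
  verts := H.verts.filter fun x => Reach (H.edges \ S) v x ∧ Reach (H.edges \ S) x v
  edges := (H.edges \ S).filter fun e =>
    (e.1 ∈ H.verts.filter fun x => Reach (H.edges \ S) v x ∧ Reach (H.edges \ S) x v) ∧
    (e.2 ∈ H.verts.filter fun x => Reach (H.edges \ S) v x ∧ Reach (H.edges \ S) x v)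
  fst_mem := fun _ he => (Finset.mem_filter.mp he).2.1
  snd_mem := fun _ he => (Finset.mem_filter.mp he).2.2

/-- Vertices reachable from `v` by a walk of weight at most `r`. -/
def outBall (H : FinDigraph V) (w : V → V → ℝ) (v : V) (r : ℝ) : Finset V :=
  H.verts.filter fun x => ∃ P, IsWalkFromTo H v x P ∧ walkWeight w P ≤ r

/-- Vertices from which `v` is reachable by a walk of weight at most `r`. -/
def inBall (H : FinDigraph V) (w : V → V → ℝ) (v : V) (r : ℝ) : Finset V :=
  H.verts.filter fun x => ∃ P, IsWalkFromTo H x v P ∧ walkWeight w P ≤ r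

/-- The progress property of a set `S` of removed edges: every strongly connected component of
`H ∖ S` has at most `3/4` of the vertices, or all its vertices have in- and out-balls of radius
`d / 4` in `H_{≥0}` with more than half of the vertices. -/
def Progress (w : V → V → ℝ) (H : FinDigraph V) (d : ℝ) (S : Finset (V × V)) : Prop :=
  ∀ v ∈ H.verts,
    4 * (scc H S v).verts.card ≤ 3 * H.verts.card ∨
    ∀ x ∈ (scc H S v).verts,
      H.verts.card < 2 * (outBall H (nonnegWt w) x (d / 4)).card ∧
      H.verts.card < 2 * (inBall H (nonnegWt w) x (d / 4)).card

/-- Number of edges of the walk `P` inside `S`, with multiplicity. -/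
def hits (S : Finset (V × V)) (P : List V) : ℕ := (walkEdges P).countP fun e => e ∈ S

/-- The output guarantees of `Decompose(H, d)` for a law of the random set `S` of removed edges:
`S` consists of positive-weight edges of `H`; the progress property fails with probability at most
`N ^ (-κ)`; and every walk of length at most `d` in `H_{≥0}` has at most `c log N` edges in `S` in
expectation.  Here `N` is the number of vertices of the input graph. -/
structure IsDecomposition [Fintype V] (c κ : ℝ) (N : ℕ) (w : V → V → ℝ) (H : FinDigraph V) (d : ℝ)
    (law : PMF (Finset (V × V))) : Prop where
  positive : ∀ S ∈ law.support, ∀ e ∈ S, e ∈ H.edges ∧ 0 < w e.1 e.2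
  progress : (∑ S : Finset (V × V), if Progress w H d S then 0 else law S) ≤
    ENNReal.ofReal ((N : ℝ) ^ (-κ))
  sparse : ∀ P, IsWalk H P → walkWeight (nonnegWt w) P ≤ d →
    (∑ S : Finset (V × V), law S * (hits S P : ENNReal)) ≤ ENNReal.ofReal (c * Real.log N)

/-! ### The decomposition tree -/

/-- The outcomes of all calls to `Decompose`: `σ (H, d)` is the set returned by the call on
`(H, d)`.  The nodes of one decomposition tree are pairwise distinct pairs `(H, d)`. -/
abbrev Outcome (V : Type u) := FinDigraph V × ℝ → Finset (V × V)

/-- The diameter parameter of the child `C` of the node `(H, d)`. -/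
def childParam (H C : FinDigraph V) (d : ℝ) : ℝ :=
  if 4 * C.verts.card ≤ 3 * H.verts.card then d else d / 2

/-- The diameter parameter of the root. -/
def rootParam (V : Type u) [Fintype V] (W : ℝ) : ℝ := (Fintype.card V : ℝ) * W / 2

/-- The non-leaf nodes of the decomposition tree, i.e. the arguments of the recursive calls of
`BuildDecompositionTree`, starting from `(G', nW/2)`. -/
inductive IsInternalNode [Fintype V] (E : Finset (V × V)) (W : ℝ) (σ : Outcome V) :
    FinDigraph V → ℝ → Prop
  | root : IsInternalNode E W σ (rootGraph E) (rootParam V W)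
  | child (H : FinDigraph V) (d : ℝ) (v : V) : IsInternalNode E W σ H d → v ∈ H.verts →
      W / 2 < childParam H (scc H (σ (H, d)) v) d →
      IsInternalNode E W σ (scc H (σ (H, d)) v) (childParam H (scc H (σ (H, d)) v) d)

/-- `C` is (the graph of) a leaf of the decomposition tree. -/
def IsLeaf [Fintype V] (E : Finset (V × V)) (W : ℝ) (σ : Outcome V) (C : FinDigraph V) : Prop :=
  ∃ H d v, IsInternalNode E W σ H d ∧ v ∈ H.verts ∧ C = scc H (σ (H, d)) v ∧
    childParam H C d ≤ W / 2

/-- Phase 1 finds a negative edge in a leaf, so that the algorithm stops before Phase 2. -/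
def CaughtAtLeaf [Fintype V] (E : Finset (V × V)) (w : V → V → ℝ) (W : ℝ) (σ : Outcome V) : Prop :=
  ∃ C, IsLeaf E W σ C ∧ ∃ e ∈ C.edges, w e.1 e.2 < 0

/-- The progress property holds for all decompositions of the tree. -/
def AllProgress [Fintype V] (E : Finset (V × V)) (w : V → V → ℝ) (W : ℝ) (σ : Outcome V) : Prop :=
  ∀ H d, IsInternalNode E W σ H d → Progress w H d (σ (H, d))

/-- The output step, for a walk `P` from `u` to `v`: `G'_{≥0}` has a shortest path from `v` back to
`u`, and concatenating `P` with any such path gives a negative-weight cycle of `G`. -/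
def ClosesToNegCycle [Fintype V] (E : Finset (V × V)) (wG : V → V → ℤ) (W : ℝ) (u v : V)
    (P : List V) : Prop :=
  (∃ P', IsShortestWalk (rootGraph E) (nonnegWt (scaledWt wG W)) v u P') ∧
  ∀ P', IsShortestWalk (rootGraph E) (nonnegWt (scaledWt wG W)) v u P' →
    IsNegCycle (rootGraph E) (fun a b => (wG a b : ℝ)) (P ++ P'.tail)

/-! ### The Bellman-Ford/Dijkstra hybrid, as a machine that counts its steps -/

/-- The label of a vertex: the current path to it (last vertex first, a persistent linked list),
with its weight and its auxiliary weight. -/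
structure BFDLabel (X : Type u) where
  len : ℝ
  aux : ℝ
  rpath : List X

inductive BFDStatus (X : Type u)
  | dijkstra
  | bellmanFord
  /-- no label can be improved: all distances are computed -/
  | done
  /-- early termination at a vertex whose current path has too large an auxiliary weight -/
  | found (x : X)

structure BFDState (X : Type u) where
  /-- `none` stands for distance `∞` -/
  label : X → Option (BFDLabel X)
  queue : Finset X
  /-- vertices extracted from the queue in the current iteration -/
  active : Finset X
  status : BFDStatus X
  /-- number of iterations performed so far -/
  iter : ℕ
  /-- number of time units spent so far -/
  cost : ℕ

section BFD

variable {X : Type u}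

def BFDLabel.extend (w aux : X → X → ℝ) (l : BFDLabel X) (v x : X) : BFDLabel X :=
  ⟨l.len + w v x, l.aux + aux v x, x :: l.rpath⟩

/-- `l` is strictly shorter than the current label `o`. -/
def BFDLabel.Improves (l : BFDLabel X) (o : Option (BFDLabel X)) : Prop :=
  ∀ l' ∈ o, l.len < l'.len

def labelLen (label : X → Option (BFDLabel X)) (v : X) : ℝ := ((label v).map BFDLabel.len).getD 0

def outDeg (K : FinDigraph X) (v : X) : ℕ := (K.edges.filter fun e => e.1 = v).card

/-- Charge for extracting the minimum of the priority queue: `O(log log n)`. -/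
def extractCost (K : FinDigraph X) : ℕ := 1 + Nat.log 2 (Nat.log 2 K.verts.card)

/-- The relaxation of the edge `(v, x)` from the label of `v`, if there is an improvement. -/
def relaxed (w aux : X → X → ℝ) (label : X → Option (BFDLabel X)) (v x : X) :
    Option (BFDLabel X) :=
  match label v with
  | none => none
  | some l => if (l.extend w aux v x).Improves (label x) then some (l.extend w aux v x) else none

/-- One extraction of the Dijkstra phase: the vertex `v` is removed from the queue and its
outgoing edges of non-negative weight are relaxed; vertices with an improved label enter the queue.
Each outgoing edge is charged one unit. -/
def scanVertex (K : FinDigraph X) (w aux : X → X → ℝ) (st : BFDState X) (v : X) : BFDState X :=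
  let new : X → Option (BFDLabel X) := fun x =>
    if (v, x) ∈ K.edges ∧ 0 ≤ w v x then relaxed w aux st.label v x else none
  { st with
    label := fun x => (new x).or (st.label x)
    queue := st.queue.erase v ∪ K.verts.filter fun x => (new x).isSome
    active := insert v st.active
    cost := st.cost + extractCost K + outDeg K v }

/-- The active vertices with an edge of negative weight to `x`. -/
def negPreds (K : FinDigraph X) (w : X → X → ℝ) (st : BFDState X) (x : X) : Finset X :=
  st.active.filter fun v => (v, x) ∈ K.edges ∧ w v x < 0

/-- The best relaxation of an edge of negative weight from an active vertex to `x`, computed from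
the labels at the end of the Dijkstra phase. -/
def bestNegRelaxation (K : FinDigraph X) (w aux : X → X → ℝ) (st : BFDState X) (x : X) :
    Option (BFDLabel X) :=
  if h : (negPreds K w st x).Nonempty then
    relaxed w aux st.label
      (Finset.exists_min_image _ (fun v => labelLen st.label v + w v x) h).choose x
  else none

/-- The Bellman-Ford phase: all edges of negative weight leaving active vertices are relaxed. -/
def bellmanFordPhase (K : FinDigraph X) (w aux : X → X → ℝ) (st : BFDState X) : BFDState X :=
  let new := bestNegRelaxation K w aux st
  let improved := K.verts.filter fun x => (new x).isSome
  { st with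
    label := fun x => (new x).or (st.label x)
    queue := improved
    active := ∅
    status := if improved = ∅ then .done else .dijkstra
    cost := st.cost + 1 + ∑ v ∈ st.active, (1 + outDeg K v) }

/-- One step of the hybrid on the graph `K` with weights `w` and auxiliary weights `aux`, which
stops early as soon as, at the end of the Dijkstra phase of an iteration, some current path has
auxiliary weight more than `d`. -/
def bfdStep (K : FinDigraph X) (w aux : X → X → ℝ) (d : ℝ) (st : BFDState X) : BFDState X :=
  match st.status with
  | .done => st
  | .found _ => st
  | .dijkstra =>
    if h : st.queue.Nonempty then
      scanVertex K w aux st (Finset.exists_min_image st.queue (labelLen st.label) h).choose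
    else
      { st with
        status :=
          if h' : ∃ x ∈ K.verts, ∃ l ∈ st.label x, d < l.aux then .found h'.choose
          else .bellmanFord
        iter := st.iter + 1
        cost := st.cost + 1 + K.verts.card }
  | .bellmanFord => bellmanFordPhase K w aux st

def bfdInit (K : FinDigraph X) (s : X) : BFDState X where
  label := fun x => if x = s then some ⟨0, 0, [s]⟩ else none
  queue := {s}
  active := ∅
  status := .dijkstra
  iter := 0
  cost := K.verts.card

end BFD

/-- The graph `H_s`: a new source `s = none` with an edge to every vertex of `H`. -/
def withSource (H : FinDigraph V) : FinDigraph (Option V) where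
  verts := insert none (H.verts.image some)
  edges := H.verts.image (fun v => (none, some v)) ∪
    H.edges.image fun e => (some e.1, some e.2)
  fst_mem := by
    intro e he
    rcases Finset.mem_union.mp he with h | h <;> obtain ⟨a, ha, rfl⟩ := Finset.mem_image.mp h
    · simp
    · simpa using H.fst_mem a ha
  snd_mem := by
    intro e he
    rcases Finset.mem_union.mp he with h | h <;> obtain ⟨a, ha, rfl⟩ := Finset.mem_image.mp h
    · simpa using ha
    · simpa using H.snd_mem a ha

/-- Edge weights of `H_s`: the edges at the source have weight `0`. -/
def sourceWt (w : V → V → ℝ) : Option V → Option V → ℝ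
  | some u, some v => w u v
  | _, _ => 0

/-- The extension of a potential function by `φ(s) = 0`. -/
def sourcePot (φ : V → ℝ) : Option V → ℝ
  | some v => φ v
  | none => 0

/-- The state after `k` steps of the augmented `BellmanFordDijkstra(H, φ)`: the hybrid on
`(H_s)_φ`, with the weights of `H_{≥0}` as auxiliary weights and threshold `d`. -/
def bfdRun (H : FinDigraph V) (w : V → V → ℝ) (φ : V → ℝ) (d : ℝ) (k : ℕ) :
    BFDState (Option V) :=
  (bfdStep (withSource H) (reweight (sourceWt w) (sourcePot φ)) (sourceWt (nonnegWt w)) d)^[k]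
    (bfdInit (withSource H) none)

/-- Total running time (`⊤` if the run does not stop). -/
def bfdTime (H : FinDigraph V) (w : V → V → ℝ) (φ : V → ℝ) (d : ℝ) : ENNReal :=
  ⨆ k, ((bfdRun H w φ d k).cost : ENNReal)

/-- Total number of iterations (`⊤` if the run does not stop). -/
def bfdIterations (H : FinDigraph V) (w : V → V → ℝ) (φ : V → ℝ) (d : ℝ) : ENNReal :=
  ⨆ k, ((bfdRun H w φ d k).iter : ENNReal)

/-- The recorded path in `H`: the source is dropped. -/
def BFDLabel.path (l : BFDLabel (Option V)) : List V := l.rpath.reverse.reduceOption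

/-- A resource used by `BellmanFordDijkstra(H, φ)` when it is called with the potential `φ?`, and
`0` if it is not called at all (`φ? = none`, or `caught`: the algorithm stopped in Phase 1). -/
def ifReached (caught : Prop) (φ? : Option (V → ℝ)) (resource : (V → ℝ) → ENNReal) : ENNReal :=
  if caught then 0 else φ?.elim 0 resource

end

/-!
**Existence of decompositions.**  Call a vertex light if its out- or its in-ball of radius `d / 4`
contains at most half of the vertices.  Around the light vertices, one after the other, balls of a
random radius below `d / 4` are carved out, and the edges that leave an out-ball or enter an
in-ball are cut.  A strongly connected component of the rest is contained in a ball or has no light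
vertex, so the progress property is certain (`exists_carving`).  With geometric radii an edge is
cut by a ball with probability proportional to its length, given that the ball reaches it, and it
is out of danger after the first ball that reaches it; truncating the radii at `d / 4` costs only a
constant factor if the rate of the distribution is of order `log N / d`
(`exists_isDecomposition`).

**The hybrid on a graph with a negative cycle.**  A negative cycle without positive edges is never
cut and reaches a leaf (`caughtAtLeaf_of_isNegCycle`).  If there is none, then the walks of length
at most `d` in `H_{≥0}` have weights that are bounded from below, and the negative cycle prevents
the infima of these weights from being a feasible potential: there are a walk `Q` to `x` of length
at most `d` and an edge `(x, y)` such that `Q` followed by `(x, y)` is lighter than every walk to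
`y` of length at most `d` (`exists_improving_edge`).  Neither depends on the random set `S`.  After
`i` iterations the distances are at most the weights of all walks with fewer than `i` negative
edges, and after reweighting the only negative edges of `Q` are its edges in `S` and the edge at the
source.  So after as many iterations as `Q` has edges in `S`, plus three, the recorded walk to `y`
must be longer than `d`, if the run has not stopped before (`bfd_found`, `bfdRun_found`).  Sparse
hitting bounds the expected number of these edges, and each iteration takes time
`O(m + n log log n)`.

**Negative cycles of `G`.**  Weights in `G'` are at least `-W / 2`, so a walk of non-positive weight
and length more than `d` has more than `2 d / W` edges, and its weight in `G` is less than `-d`.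
Below the first halving of the diameter parameter the progress property bounds the way back by `d`
(`closesToNegCycle_of_long_walk`).  At the initial parameter the walk has more than `n` edges and
visits a vertex twice; since a label is only replaced by a strictly better one, closed segments of
recorded walks have negative weight (`LabelInv`, `exists_isNegCycle_of_long_walk`).
-/

section

variable {V : Type u}

/-! ### Walks as lists of vertices -/

@[simp] theorem walkEdges_nil : walkEdges ([] : List V) = [] := rfl

@[simp] theorem walkEdges_singleton (a : V) : walkEdges [a] = [] := rfl

@[simp] theorem walkEdges_cons_cons (a b : V) (l : List V) :
    walkEdges (a :: b :: l) = (a, b) :: walkEdges (b :: l) := rfl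

/-- Splitting a walk at one of its vertices splits its edges. -/
theorem walkEdges_glue (P : List V) (a : V) (Q : List V) :
    walkEdges (P ++ a :: Q) = walkEdges (P ++ [a]) ++ walkEdges (a :: Q) := by
  induction P with
  | nil => simp
  | cons x P ih =>
    cases P with
    | nil => simp
    | cons y P => simpa using ih

theorem walkEdges_map {X Y : Type*} (f : X → Y) (P : List X) :
    walkEdges (P.map f) = (walkEdges P).map (Prod.map f f) := by
  simp only [walkEdges]
  rw [← List.map_tail, List.zip_map]

theorem length_walkEdges (P : List V) : (walkEdges P).length = P.length - 1 := by
  simp [walkEdges]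

theorem walkWeight_eq_of_walkEdges_append {w : V → V → ℝ} {P Q R : List V}
    (h : walkEdges P = walkEdges Q ++ walkEdges R) :
    walkWeight w P = walkWeight w Q + walkWeight w R := by
  simp [walkWeight, h]

theorem walkWeight_glue (w : V → V → ℝ) (P : List V) (a : V) (Q : List V) :
    walkWeight w (P ++ a :: Q) = walkWeight w (P ++ [a]) + walkWeight w (a :: Q) :=
  walkWeight_eq_of_walkEdges_append (walkEdges_glue P a Q)

@[simp] theorem walkWeight_singleton (w : V → V → ℝ) (a : V) : walkWeight w [a] = 0 := by
  simp [walkWeight]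

@[simp] theorem walkWeight_cons_cons (w : V → V → ℝ) (a b : V) (l : List V) :
    walkWeight w (a :: b :: l) = w a b + walkWeight w (b :: l) := by
  simp [walkWeight]

theorem walkEdges_concat {P : List V} {v : V} (h : P.getLast? = some v) (x : V) :
    walkEdges (P ++ [x]) = walkEdges P ++ [(v, x)] := by
  obtain ⟨P, rfl⟩ := List.getLast?_eq_some_iff.mp h
  simpa using walkEdges_glue P v [x]

theorem walkWeight_concat (w : V → V → ℝ) {P : List V} {v : V} (h : P.getLast? = some v) (x : V) :
    walkWeight w (P ++ [x]) = walkWeight w P + w v x := by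
  simp [walkWeight, walkEdges_concat h]

theorem walkWeight_map {X Y : Type*} (w : Y → Y → ℝ) (f : X → Y) (P : List X) :
    walkWeight w (P.map f) = walkWeight (fun a b => w (f a) (f b)) P := by
  simp [walkWeight, walkEdges_map, Function.comp_def]

theorem walkWeight_mono {w w' : V → V → ℝ} {P : List V}
    (h : ∀ e ∈ walkEdges P, w e.1 e.2 ≤ w' e.1 e.2) : walkWeight w P ≤ walkWeight w' P :=
  List.sum_le_sum h

theorem walkWeight_add (w w' : V → V → ℝ) (P : List V) :
    walkWeight (fun a b => w a b + w' a b) P = walkWeight w P + walkWeight w' P := by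
  simp [walkWeight, List.sum_map_add]

theorem walkWeight_mul_left (r : ℝ) (w : V → V → ℝ) (P : List V) :
    walkWeight (fun a b => r * w a b) P = r * walkWeight w P := by
  simp [walkWeight, List.sum_map_mul_left]

theorem walkWeight_const (r : ℝ) (P : List V) :
    walkWeight (fun _ _ => r) P = (P.length - 1 : ℕ) * r := by
  simp [walkWeight, length_walkEdges]

theorem walkWeight_nonneg {w : V → V → ℝ} {P : List V} (h : ∀ e ∈ walkEdges P, 0 ≤ w e.1 e.2) :
    0 ≤ walkWeight w P :=
  List.sum_nonneg (by simpa using fun r a b hab hr => hr ▸ h (a, b) hab)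

theorem walkWeight_nonnegWt_nonneg (w : V → V → ℝ) (P : List V) :
    0 ≤ walkWeight (nonnegWt w) P :=
  walkWeight_nonneg fun _ _ => le_max_right _ _

theorem walkWeight_le_nonnegWt (w : V → V → ℝ) (P : List V) :
    walkWeight w P ≤ walkWeight (nonnegWt w) P :=
  walkWeight_mono fun _ _ => le_max_left _ _

/-- A potential that satisfies the triangle inequality on all edges of a walk grows along the walk
by at most the weight of the walk. -/
theorem potential_le_add_walkWeight {f : V → ℝ} {w : V → V → ℝ} {P : List V} {u v : V}
    (hu : P.head? = some u) (hv : P.getLast? = some v)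
    (h : ∀ e ∈ walkEdges P, f e.2 ≤ f e.1 + w e.1 e.2) : f v ≤ f u + walkWeight w P := by
  induction P generalizing u with
  | nil => simp at hu
  | cons a P ih =>
    obtain rfl : a = u := by simpa using hu
    cases P with
    | nil =>
      obtain rfl : a = v := by simpa using hv
      simp
    | cons b P =>
      have h1 := ih (u := b) rfl (by simpa [List.getLast?_cons_cons] using hv)
        (fun e he => h e (by simp [he]))
      have h2 := h (a, b) (by simp)
      simp only [walkWeight_cons_cons]
      linarith

theorem walkWeight_reweight {φ : V → ℝ} {w : V → V → ℝ} {P : List V} {u v : V}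
    (hu : P.head? = some u) (hv : P.getLast? = some v) :
    walkWeight (reweight w φ) P = walkWeight w P + φ u - φ v := by
  induction P generalizing u with
  | nil => simp at hu
  | cons a P ih =>
    obtain rfl : a = u := by simpa using hu
    cases P with
    | nil =>
      obtain rfl : a = v := by simpa using hv
      simp
    | cons b P =>
      have h1 := ih (u := b) rfl (by simpa [List.getLast?_cons_cons] using hv)
      simp only [walkWeight_cons_cons, h1, reweight]
      ring

theorem isWalk_singleton {H : FinDigraph V} {v : V} (hv : v ∈ H.verts) :
    IsWalkFromTo H v v [v] :=
  ⟨⟨by simp, by simpa using hv, by simp⟩, rfl, rfl⟩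

theorem IsWalkFromTo.concat {H : FinDigraph V} {u v x : V} {P : List V}
    (h : IsWalkFromTo H u v P) (hx : (v, x) ∈ H.edges) : IsWalkFromTo H u x (P ++ [x]) := by
  obtain ⟨⟨h1, h2, h3⟩, h4, h5⟩ := h
  refine ⟨⟨by simp, ?_, ?_⟩, ?_, by simp⟩
  · intro y hy
    rcases List.mem_append.mp hy with hy | hy
    · exact h2 y hy
    · obtain rfl : y = x := by simpa using hy
      exact H.snd_mem _ hx
  · intro e he
    rw [walkEdges_concat h5] at he
    rcases List.mem_append.mp he with he | he
    · exact h3 e he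
    · obtain rfl : e = (v, x) := by simpa using he
      exact hx
  · obtain ⟨t, rfl⟩ := List.head?_eq_some_iff.mp h4
    rfl

theorem IsWalkFromTo.eq_append {H : FinDigraph V} {u v x : V} {P Q : List V}
    (h : IsWalkFromTo H u v P) (h' : IsWalkFromTo H v x Q) :
    ∃ A B, P = A ++ [v] ∧ Q = v :: B ∧ P ++ Q.tail = A ++ v :: B := by
  obtain ⟨A, rfl⟩ := List.getLast?_eq_some_iff.mp h.2.2
  obtain ⟨B, rfl⟩ := List.head?_eq_some_iff.mp h'.2.1
  exact ⟨A, B, rfl, rfl, by simp⟩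

theorem walkWeight_append_tail {H : FinDigraph V} {u v x : V} {P Q : List V} (w : V → V → ℝ)
    (h : IsWalkFromTo H u v P) (h' : IsWalkFromTo H v x Q) :
    walkWeight w (P ++ Q.tail) = walkWeight w P + walkWeight w Q := by
  obtain ⟨A, B, rfl, rfl, e⟩ := h.eq_append h'
  rw [e, walkWeight_glue]

theorem IsWalkFromTo.append_tail {H : FinDigraph V} {u v x : V} {P Q : List V}
    (h : IsWalkFromTo H u v P) (h' : IsWalkFromTo H v x Q) :
    IsWalkFromTo H u x (P ++ Q.tail) := by
  obtain ⟨A, B, rfl, rfl, e⟩ := h.eq_append h'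
  obtain ⟨⟨h1, h2, h3⟩, h4, h5⟩ := h
  obtain ⟨⟨k1, k2, k3⟩, k4, k5⟩ := h'
  rw [e]
  refine ⟨⟨by simp, ?_, ?_⟩, ?_, ?_⟩
  · intro y hy
    rcases List.mem_append.mp hy with hy | hy
    · exact h2 y (by simp [hy])
    · exact k2 y hy
  · intro y hy
    rw [walkEdges_glue] at hy
    rcases List.mem_append.mp hy with hy | hy
    · exact h3 y hy
    · exact k3 y hy
  · cases A <;> simpa using h4
  · rw [List.getLast?_append_of_ne_nil _ (by simp)]
    exact k5

theorem IsWalk.mono {H K : FinDigraph V} (hv : H.verts ⊆ K.verts) (he : H.edges ⊆ K.edges)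
    {P : List V} (h : IsWalk H P) : IsWalk K P :=
  ⟨h.1, fun v hv' => hv (h.2 v hv'), fun e he' => he (h.3 e he')⟩

theorem IsWalkFromTo.mono {H K : FinDigraph V} (hv : H.verts ⊆ K.verts) (he : H.edges ⊆ K.edges)
    {u v : V} {P : List V} (h : IsWalkFromTo H u v P) : IsWalkFromTo K u v P :=
  ⟨h.1.mono hv he, h.2⟩

theorem mem_walkEdges_of_infix {P Q : List V} (h : P <:+: Q) {e : V × V} (he : e ∈ walkEdges P) :
    e ∈ walkEdges Q := by
  obtain ⟨A, B, rfl⟩ := h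
  cases P with
  | nil => simp at he
  | cons a P =>
    have h1 : walkEdges (A ++ (a :: P) ++ B) =
        walkEdges (A ++ [a]) ++ walkEdges (a :: (P ++ B)) := by
      rw [← walkEdges_glue]; simp
    rw [h1]
    refine List.mem_append_right _ ?_
    clear h1
    induction P generalizing a with
    | nil => simp at he
    | cons b P ih =>
      simp only [walkEdges_cons_cons, List.mem_cons, List.cons_append] at he ⊢
      exact he.imp id (ih b)

theorem IsWalk.of_infix {H : FinDigraph V} {P Q : List V} (hQ : IsWalk H Q) (h : P <:+: Q)
    (hP : P ≠ []) : IsWalk H P :=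
  ⟨hP, fun v hv => hQ.2 v (h.subset hv), fun e he => hQ.3 e (mem_walkEdges_of_infix h he)⟩

theorem List.exists_eq_of_not_nodup {P : List V} (h : ¬ P.Nodup) :
    ∃ A a B C, P = A ++ a :: (B ++ a :: C) := by
  induction P with
  | nil => simp at h
  | cons x P ih =>
    rw [List.nodup_cons, not_and_or, not_not] at h
    rcases h with h | h
    · obtain ⟨B, C, rfl⟩ := List.append_of_mem h
      exact ⟨[], x, B, C, rfl⟩
    · obtain ⟨A, a, B, C, rfl⟩ := ih h
      exact ⟨x :: A, a, B, C, rfl⟩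

theorem isCycle_of_infix {H : FinDigraph V} {P : List V} (hP : IsWalk H P) {a : V} {B : List V}
    (h : a :: (B ++ [a]) <:+: P) : IsCycle H (a :: (B ++ [a])) := by
  refine ⟨hP.of_infix h (by simp), by simp, ?_⟩
  rw [← List.cons_append, List.getLast?_concat]
  rfl

/-! ### Shortest walks and potentials in graphs without negative cycles -/

/-- Removing closed subwalks turns a walk into one that repeats no vertex. -/
theorem exists_nodup_walk {K : FinDigraph V} {w : V → V → ℝ}
    (hK : ∀ P, IsCycle K P → 0 ≤ walkWeight w P) {u v : V} {P : List V}
    (hP : IsWalkFromTo K u v P) :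
    ∃ P', IsWalkFromTo K u v P' ∧ P'.Nodup ∧ walkWeight w P' ≤ walkWeight w P := by
  induction hn : P.length using Nat.strong_induction_on generalizing P with
  | _ n ih =>
  by_cases hd : P.Nodup
  · exact ⟨P, hP, hd, le_rfl⟩
  obtain ⟨A, a, B, C, rfl⟩ := List.exists_eq_of_not_nodup hd
  have e1 : A ++ a :: (B ++ a :: C) = A ++ (a :: (B ++ [a])) ++ C := by simp
  have hcyc : IsCycle K (a :: (B ++ [a])) := isCycle_of_infix hP.1 ⟨A, C, e1.symm⟩
  have ew : walkWeight w (A ++ a :: (B ++ a :: C)) =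
      walkWeight w (A ++ a :: C) + walkWeight w (a :: (B ++ [a])) := by
    rw [walkWeight_glue, walkWeight_glue w A a C, ← List.cons_append, walkWeight_glue w (a :: B)]
    simp only [List.cons_append]
    ring
  have hwalk : IsWalkFromTo K u v (A ++ a :: C) := by
    obtain ⟨⟨h1, h2, h3⟩, h4, h5⟩ := hP
    refine ⟨⟨by simp, fun y hy => h2 y ?_, fun e he => h3 e ?_⟩, ?_, ?_⟩
    · simp only [List.mem_append, List.mem_cons] at hy ⊢
      tauto
    · rw [walkEdges_glue] at he
      rw [walkEdges_glue, ← List.cons_append, walkEdges_glue (a :: B)]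
      simp only [List.mem_append] at he ⊢
      tauto
    · cases A <;> simpa using h4
    · rw [List.getLast?_append_of_ne_nil _ (by simp)] at h5 ⊢
      rw [← List.cons_append, List.getLast?_append_of_ne_nil _ (by simp)] at h5
      exact h5
  obtain ⟨P', h1, h2, h3⟩ := ih _ (by subst hn; simp) hwalk rfl
  exact ⟨P', h1, h2, by linarith [hK _ hcyc]⟩

theorem finite_nodup_lists [Finite V] : {P : List V | P.Nodup}.Finite := by
  have := Fintype.ofFinite V
  exact (List.finite_length_le V (Fintype.card V)).subset fun P hP => hP.length_le_card

theorem exists_isShortestWalk [Finite V] {K : FinDigraph V} {w : V → V → ℝ}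
    (hK : ∀ P, IsCycle K P → 0 ≤ walkWeight w P) {u v : V} {P : List V}
    (hP : IsWalkFromTo K u v P) : ∃ P', IsShortestWalk K w u v P' := by
  obtain ⟨P₁, h1, h2, -⟩ := exists_nodup_walk hK hP
  obtain ⟨P₂, ⟨-, k2⟩, k3⟩ := Set.exists_min_image {P | P.Nodup ∧ IsWalkFromTo K u v P}
    (walkWeight w) (finite_nodup_lists.subset fun P hP => hP.1) ⟨P₁, h2, h1⟩
  refine ⟨P₂, k2, fun P' hP' => ?_⟩
  obtain ⟨P₃, m1, m2, m3⟩ := exists_nodup_walk hK hP'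
  exact (k3 P₃ ⟨m2, m1⟩).trans m3

theorem exists_feasible_potential [Finite V] {K : FinDigraph V} {w : V → V → ℝ}
    (hK : ∀ P, IsCycle K P → 0 ≤ walkWeight w P) :
    ∃ ρ : V → ℝ, ∀ e ∈ K.edges, ρ e.2 ≤ ρ e.1 + w e.1 e.2 := by
  have key : ∀ x : V, ∃ r : ℝ, x ∈ K.verts →
      (∃ u P, IsWalkFromTo K u x P ∧ walkWeight w P = r) ∧
      ∀ u P, IsWalkFromTo K u x P → r ≤ walkWeight w P := by
    intro x
    by_cases hx : x ∈ K.verts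
    · obtain ⟨P₂, hP₂, k3⟩ := Set.exists_min_image
        {P | P.Nodup ∧ ∃ u, IsWalkFromTo K u x P} (walkWeight w)
        (finite_nodup_lists.subset fun P hP => hP.1) ⟨[x], by simp, x, isWalk_singleton hx⟩
      obtain ⟨-, u, hu⟩ := hP₂
      refine ⟨_, fun _ => ⟨⟨u, P₂, hu, rfl⟩, fun u' P' hP' => ?_⟩⟩
      obtain ⟨P₃, m1, m2, m3⟩ := exists_nodup_walk hK hP'
      exact (k3 P₃ ⟨m2, u', m1⟩).trans m3
    · exact ⟨0, fun h => absurd h hx⟩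
  choose ρ hρ using key
  refine ⟨ρ, fun e he => ?_⟩
  obtain ⟨⟨u, P, hP, hr⟩, -⟩ := hρ e.1 (K.fst_mem e he)
  have := (hρ e.2 (K.snd_mem e he)).2 u _ (hP.concat he)
  rwa [walkWeight_concat w hP.2.2, hr] at this

/-! ### Labels of the hybrid -/

section Machine

variable {X : Type u}

/-- The current distance of `x` is finite and at most `r`. -/
def LabelLE (label : X → Option (BFDLabel X)) (x : X) (r : ℝ) : Prop :=
  ∃ l, label x = some l ∧ l.len ≤ r

theorem LabelLE.mono {label : X → Option (BFDLabel X)} {x : X} {r r' : ℝ}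
    (h : LabelLE label x r) (hr : r ≤ r') : LabelLE label x r' :=
  let ⟨l, h1, h2⟩ := h
  ⟨l, h1, h2.trans hr⟩

theorem labelLen_eq {label : X → Option (BFDLabel X)} {x : X} {l : BFDLabel X}
    (h : label x = some l) : labelLen label x = l.len := by
  simp [labelLen, h]

/-- The labels in `new` arise by relaxing edges of `K` with an improvement, all of them computed
from the labels in `label`. -/
def IsRelaxation (K : FinDigraph X) (w aux : X → X → ℝ)
    (label new : X → Option (BFDLabel X)) : Prop :=
  ∀ x l', new x = some l' → ∃ v l, label v = some l ∧ (v, x) ∈ K.edges ∧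
    l' = l.extend w aux v x ∧ l'.Improves (label x)

/-- The labels describe walks from `s`.  Distances only ever decrease, and a label extends the
label that its predecessor had at the time; therefore no initial segment of a recorded walk is
shorter than the current distance of its endpoint, and every closed segment of a recorded walk
has negative weight. -/
structure LabelInv (K : FinDigraph X) (w aux : X → X → ℝ) (s : X)
    (label : X → Option (BFDLabel X)) : Prop where
  walk : ∀ {x l}, label x = some l → IsWalkFromTo K s x l.rpath.reverse
  len_eq : ∀ {x l}, label x = some l → l.len = walkWeight w l.rpath.reverse
  aux_eq : ∀ {x l}, label x = some l → l.aux = walkWeight aux l.rpath.reverse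
  prefix_le : ∀ {x l}, label x = some l → ∀ A y, A ++ [y] <+: l.rpath.reverse →
    LabelLE label y (walkWeight w (A ++ [y]))
  closed_neg : ∀ {x l}, label x = some l → ∀ a B, a :: (B ++ [a]) <:+: l.rpath.reverse →
    walkWeight w (a :: (B ++ [a])) < 0

variable {K : FinDigraph X} {w aux : X → X → ℝ} {s : X} {d : ℝ}

theorem LabelLE.update {label new : X → Option (BFDLabel X)}
    (hn : IsRelaxation K w aux label new) {x : X} {r : ℝ} (h : LabelLE label x r) :
    LabelLE (fun x => (new x).or (label x)) x r := by
  obtain ⟨l, h1, h2⟩ := h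
  cases hx : new x with
  | none => exact ⟨l, by simp [hx, h1], h2⟩
  | some l' =>
    obtain ⟨v, l₀, -, -, -, hi⟩ := hn x l' hx
    exact ⟨l', by simp [hx], ((hi l (by simp [h1])).le).trans h2⟩

theorem LabelInv.mem_verts {label : X → Option (BFDLabel X)} (h : LabelInv K w aux s label)
    {x : X} (hx : (label x).isSome) : x ∈ K.verts := by
  obtain ⟨l, hl⟩ := Option.isSome_iff_exists.mp hx
  have := h.walk hl
  exact this.1.2 x (List.mem_of_getLast? this.2.2)

theorem LabelInv.update {label new : X → Option (BFDLabel X)} (h : LabelInv K w aux s label)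
    (hn : IsRelaxation K w aux label new) :
    LabelInv K w aux s (fun x => (new x).or (label x)) := by
  have key : ∀ {x l'}, (new x).or (label x) = some l' → label x = some l' ∨
      ∃ v l, label v = some l ∧ (v, x) ∈ K.edges ∧
        l'.len = l.len + w v x ∧ l'.aux = l.aux + aux v x ∧
        l'.rpath.reverse = l.rpath.reverse ++ [x] ∧ l'.Improves (label x) ∧
        (new x).or (label x) = some l' := by
    intro x l' hx
    cases hx' : new x with
    | none => left; simpa [hx'] using hx
    | some l₁ =>
      right
      obtain rfl : l₁ = l' := by simpa [hx'] using hx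
      obtain ⟨v, l, h1, h2, rfl, h4⟩ := hn x _ hx'
      exact ⟨v, l, h1, h2, rfl, rfl, by simp [BFDLabel.extend], h4, by simp⟩
  refine ⟨?_, ?_, ?_, ?_, ?_⟩
  · intro x l hx
    rcases key hx with hx | ⟨v, l₀, h1, h2, -, -, h5, -⟩
    · exact h.walk hx
    · rw [h5]; exact (h.walk h1).concat h2
  · intro x l hx
    rcases key hx with hx | ⟨v, l₀, h1, h2, h3, -, h5, -⟩
    · exact h.len_eq hx
    · rw [h5, walkWeight_concat w (h.walk h1).2.2, h3, h.len_eq h1]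
  · intro x l hx
    rcases key hx with hx | ⟨v, l₀, h1, h2, -, h4, h5, -⟩
    · exact h.aux_eq hx
    · rw [h5, walkWeight_concat aux (h.walk h1).2.2, h4, h.aux_eq h1]
  · intro x l hx A y hA
    rcases key hx with hx | ⟨v, l₀, h1, h2, h3, -, h5, -, h7⟩
    · exact (h.prefix_le hx A y hA).update hn
    · rw [h5, List.prefix_concat_iff] at hA
      rcases hA with hA | hA
      · obtain ⟨rfl, hy⟩ := List.append_inj' hA rfl
        obtain rfl : y = x := by simpa using hy
        exact ⟨l, h7, by rw [walkWeight_concat w (h.walk h1).2.2, h3, h.len_eq h1]⟩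
      · exact (h.prefix_le h1 A y hA).update hn
  · intro x l hx a B hB
    rcases key hx with hx | ⟨v, l₀, h1, h2, h3, -, h5, h6, h7⟩
    · exact h.closed_neg hx a B hB
    · rw [h5, List.infix_concat_iff] at hB
      rcases hB with ⟨A, hA⟩ | hB
      · have hA' : (A ++ a :: B) ++ [a] = l₀.rpath.reverse ++ [x] := by simpa using hA
        obtain ⟨hp, ha⟩ := List.append_inj' hA' rfl
        obtain rfl : a = x := by simpa using ha
        obtain ⟨l₁, k1, k2⟩ := h.prefix_le h1 A a ⟨B, by simpa using hp⟩
        have k3 := h6 l₁ (by simp [k1])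
        have k4 := walkWeight_concat w (h.walk h1).2.2 a
        rw [← hA, walkWeight_glue] at k4
        have k5 := h.len_eq h1
        linarith
      · exact h.closed_neg h1 a B hB

theorem relaxed_eq_some {label : X → Option (BFDLabel X)} {v x : X} {l' : BFDLabel X}
    (h : relaxed w aux label v x = some l') :
    ∃ l, label v = some l ∧ l' = l.extend w aux v x ∧ l'.Improves (label x) := by
  unfold relaxed at h
  cases hv : label v with
  | none => simp [hv] at h
  | some l =>
    simp only [hv] at h
    split_ifs at h with hi
    obtain rfl : l.extend w aux v x = l' := by simpa using h
    exact ⟨l, rfl, rfl, hi⟩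

theorem labelLE_relaxed_or {label : X → Option (BFDLabel X)} {v x : X} {l : BFDLabel X}
    (hv : label v = some l) {o : Option (BFDLabel X)}
    (ho : (relaxed w aux label v x).or (label x) = o) :
    ∃ l', o = some l' ∧ l'.len ≤ l.len + w v x := by
  subst ho
  unfold relaxed
  simp only [hv]
  split_ifs with hi
  · exact ⟨_, rfl, le_rfl⟩
  · simp only [BFDLabel.Improves, not_forall] at hi
    obtain ⟨l', h1, h2⟩ := hi
    exact ⟨l', by simpa using h1, not_lt.mp h2⟩

/-- There is a walk from `s` to the vertex with the given number of negative edges and the given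
weight. -/
inductive NegWalk (K : FinDigraph X) (w : X → X → ℝ) (s : X) : X → ℕ → ℝ → Prop
  | nil : NegWalk K w s s 0 0
  | nonneg {v : X} {k : ℕ} {r : ℝ} (x : X) : NegWalk K w s v k r → (v, x) ∈ K.edges →
      0 ≤ w v x → NegWalk K w s x k (r + w v x)
  | neg {v : X} {k : ℕ} {r : ℝ} (x : X) : NegWalk K w s v k r → (v, x) ∈ K.edges →
      w v x < 0 → NegWalk K w s x (k + 1) (r + w v x)

/-! ### Invariants of the hybrid -/

/-- The invariants of a run.  Besides facts about the labels: an edge can only allow an improvement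
if it starts in the queue, or if it is negative and starts at an active vertex (`relaxed_nonneg`,
`relaxed_neg`); vertices leave the queue in the order of their distances within one Dijkstra
phase (`order`); and after `i` Dijkstra phases no walk with fewer than `i` negative edges is
shorter than the current distance of its endpoint (`short`, `short_neg`). -/
structure BFDInv (K : FinDigraph X) (w aux : X → X → ℝ) (s : X) (d : ℝ) (st : BFDState X) :
    Prop where
  labels : LabelInv K w aux s st.label
  source : LabelLE st.label s 0
  queue_isSome : ∀ q ∈ st.queue, (st.label q).isSome
  active_isSome : ∀ a ∈ st.active, (st.label a).isSome
  disjoint : ∀ a ∈ st.active, a ∉ st.queue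
  order : ∀ a ∈ st.active, ∀ q ∈ st.queue, labelLen st.label a ≤ labelLen st.label q
  relaxed_nonneg : ∀ v x l, (v, x) ∈ K.edges → 0 ≤ w v x → st.label v = some l → v ∉ st.queue →
    LabelLE st.label x (l.len + w v x)
  relaxed_neg : ∀ v x l, (v, x) ∈ K.edges → w v x < 0 → st.label v = some l → v ∉ st.queue →
    v ∉ st.active → LabelLE st.label x (l.len + w v x)
  short : ∀ v k r, NegWalk K w s v k r → k < st.iter → LabelLE st.label v r
  short_neg : st.status = .dijkstra → ∀ v x k r, NegWalk K w s v k r → k < st.iter →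
    (v, x) ∈ K.edges → w v x < 0 → LabelLE st.label x (r + w v x)
  bellmanFord : st.status = .bellmanFord →
    st.queue = ∅ ∧ ∀ x ∈ K.verts, ∀ l ∈ st.label x, l.aux ≤ d
  done : st.status = .done → st.queue = ∅ ∧ st.active = ∅
  found : ∀ x, st.status = .found x →
    x ∈ K.verts ∧ 0 < st.iter ∧ ∃ l, st.label x = some l ∧ d < l.aux

theorem bfdInv_init (hs : s ∈ K.verts) : BFDInv K w aux s d (bfdInit K s) := by
  have hlab : ∀ {x l}, (bfdInit K s).label x = some l → x = s ∧ l = ⟨0, 0, [s]⟩ := by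
    intro x l h
    simp only [bfdInit] at h
    split_ifs at h with hx
    exact ⟨hx, by simpa using h.symm⟩
  have hsrc : LabelLE (bfdInit K s).label s 0 := ⟨⟨0, 0, [s]⟩, by simp [bfdInit], le_rfl⟩
  constructor
  · constructor
    · intro x l h
      obtain ⟨rfl, rfl⟩ := hlab h
      exact isWalk_singleton hs
    · intro x l h
      obtain ⟨rfl, rfl⟩ := hlab h
      simp
    · intro x l h
      obtain ⟨rfl, rfl⟩ := hlab h
      simp
    · intro x l h A y hA
      obtain ⟨rfl, rfl⟩ := hlab h
      have h1 := hA.length_le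
      have h2 : A = [] := by
        cases A with
        | nil => rfl
        | cons => simp at h1
      subst h2
      obtain rfl : y = x := by simpa using hA
      simpa using hsrc
    · intro x l h a B hB
      obtain ⟨rfl, rfl⟩ := hlab h
      have := hB.length_le
      simp at this
  · exact hsrc
  all_goals simp [bfdInit]
  all_goals exact fun v x l _ _ hv _ hv' => absurd hv hv'

theorem isRelaxation_scan (K : FinDigraph X) (w aux : X → X → ℝ)
    (label : X → Option (BFDLabel X)) (v : X) : IsRelaxation K w aux label
      (fun x => if (v, x) ∈ K.edges ∧ 0 ≤ w v x then relaxed w aux label v x else none) := by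
  intro x l' h
  dsimp only at h
  split_ifs at h with he
  obtain ⟨l, h1, h2, h3⟩ := relaxed_eq_some h
  exact ⟨v, l, h1, he.1, h2, h3⟩

theorem isRelaxation_bestNegRelaxation (K : FinDigraph X) (w aux : X → X → ℝ) (st : BFDState X) :
    IsRelaxation K w aux st.label (bestNegRelaxation K w aux st) := by
  intro x l' h
  unfold bestNegRelaxation at h
  split_ifs at h with he
  have hc := (Finset.exists_min_image _ (fun v => labelLen st.label v + w v x) he).choose_spec.1
  obtain ⟨l, h1, h2, h3⟩ := relaxed_eq_some h
  exact ⟨_, l, h1, (Finset.mem_filter.mp hc).2.1, h2, h3⟩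

theorem labelLE_bestNegRelaxation_or {st : BFDState X}
    (hact : ∀ a ∈ st.active, (st.label a).isSome) {v x : X} {l : BFDLabel X}
    (hv : st.label v = some l) (ha : v ∈ st.active) (he : (v, x) ∈ K.edges) (hw : w v x < 0) :
    LabelLE (fun x => (bestNegRelaxation K w aux st x).or (st.label x)) x (l.len + w v x) := by
  have hvm : v ∈ negPreds K w st x := Finset.mem_filter.mpr ⟨ha, he, hw⟩
  have hne : (negPreds K w st x).Nonempty := ⟨v, hvm⟩
  obtain ⟨h1, h2⟩ := (Finset.exists_min_image _
    (fun v => labelLen st.label v + w v x) hne).choose_spec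
  set u := (Finset.exists_min_image _ (fun v => labelLen st.label v + w v x) hne).choose with hu
  obtain ⟨lu, hlu⟩ := Option.isSome_iff_exists.mp (hact u (Finset.mem_filter.mp h1).1)
  have h3 := h2 v hvm
  rw [labelLen_eq hlu, labelLen_eq hv] at h3
  obtain ⟨l', k1, k2⟩ := labelLE_relaxed_or (w := w) (aux := aux) (x := x) hlu rfl
  refine ⟨l', ?_, k2.trans h3⟩
  simp only [bestNegRelaxation, hne, dite_true]
  exact k1

theorem BFDInv.scanVertex {st : BFDState X} (h : BFDInv K w aux s d st)
    (hst : st.status = .dijkstra) {v : X} (hv : v ∈ st.queue)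
    (hmin : ∀ q ∈ st.queue, labelLen st.label v ≤ labelLen st.label q) :
    BFDInv K w aux s d (scanVertex K w aux st v) ∧ v ∉ st.active := by
  have hrel := isRelaxation_scan K w aux st.label v
  unfold _root_.scanVertex
  set new : X → Option (BFDLabel X) := fun x =>
    if (v, x) ∈ K.edges ∧ 0 ≤ w v x then relaxed w aux st.label v x else none with hnew
  obtain ⟨lv, hlv⟩ := Option.isSome_iff_exists.mp (h.queue_isSome v hv)
  have hvact : v ∉ st.active := fun ha => h.disjoint v ha hv
  have hnewlen : ∀ {x l'}, new x = some l' → lv.len ≤ l'.len ∧ l'.Improves (st.label x) := by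
    intro x l' hx
    simp only [hnew] at hx
    split_ifs at hx with he
    obtain ⟨l, h1, h2, h3⟩ := relaxed_eq_some hx
    obtain rfl : lv = l := by simpa [hlv] using h1
    exact ⟨by rw [h2]; simpa [BFDLabel.extend] using he.2, h3⟩
  have hkeep : ∀ a ∈ insert v st.active, (st.label a).isSome ∧ labelLen st.label a ≤ lv.len ∧
      new a = none := by
    intro a ha
    obtain ⟨la, hla, hle⟩ : ∃ la, st.label a = some la ∧ la.len ≤ lv.len := by
      rcases Finset.mem_insert.mp ha with rfl | ha
      · exact ⟨lv, hlv, le_rfl⟩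
      · obtain ⟨la, hla⟩ := Option.isSome_iff_exists.mp (h.active_isSome a ha)
        have := h.order a ha v hv
        rw [labelLen_eq hla, labelLen_eq hlv] at this
        exact ⟨la, hla, this⟩
    refine ⟨by simp [hla], by rwa [labelLen_eq hla], ?_⟩
    cases hx : new a with
    | none => rfl
    | some l' =>
      obtain ⟨h1, h2⟩ := hnewlen hx
      have := h2 la (by simp [hla])
      linarith
  have hstay : ∀ {y l}, y ∈ K.verts → (new y).or (st.label y) = some l →
      y ∉ st.queue.erase v ∪ K.verts.filter (fun x => (new x).isSome) →
      st.label y = some l ∧ (y ≠ v → y ∉ st.queue) := by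
    intro y l hy hl hq
    simp only [Finset.mem_union, Finset.mem_erase, Finset.mem_filter, not_or, not_and] at hq
    have hn : new y = none := by simpa using hq.2 hy
    exact ⟨by simpa [hn] using hl, hq.1⟩
  refine ⟨?_, hvact⟩
  constructor
  · exact h.labels.update hrel
  · exact h.source.update hrel
  · intro q hq
    rcases Finset.mem_union.mp hq with hq | hq
    · have := h.queue_isSome q (Finset.mem_of_mem_erase hq)
      simp [this]
    · simp [(Finset.mem_filter.mp hq).2]
  · intro a ha
    simp [(hkeep a ha).1]
  · intro a ha hq
    have hk := hkeep a ha
    rcases Finset.mem_union.mp hq with hq | hq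
    · rcases Finset.mem_insert.mp ha with rfl | ha
      · simp at hq
      · exact h.disjoint a ha (Finset.mem_of_mem_erase hq)
    · simp [hk.2.2] at hq
  · intro a ha q hq
    have hk := hkeep a ha
    have e1 : labelLen (fun x => (new x).or (st.label x)) a = labelLen st.label a := by
      simp [labelLen, hk.2.2]
    rw [e1]
    cases hx : new q with
    | some l' =>
      have e2 : labelLen (fun x => (new x).or (st.label x)) q = l'.len :=
        labelLen_eq (by simp [hx])
      rw [e2]
      exact hk.2.1.trans (hnewlen hx).1
    | none =>
      have e2 : labelLen (fun x => (new x).or (st.label x)) q = labelLen st.label q := by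
        simp [labelLen, hx]
      rw [e2]
      rcases Finset.mem_union.mp hq with hq | hq
      · have := hmin q (Finset.mem_of_mem_erase hq)
        rw [labelLen_eq hlv] at this
        exact hk.2.1.trans this
      · simp [hx] at hq
  · intro y x l he hw hl hq
    obtain ⟨hl', hq'⟩ := hstay (K.fst_mem _ he) hl hq
    by_cases hyv : y = v
    · subst hyv
      obtain ⟨l', k1, k2⟩ := labelLE_relaxed_or (w := w) (aux := aux) (x := x) hl' rfl
      exact ⟨l', by simpa [hnew, he, hw] using k1, k2⟩
    · exact (h.relaxed_nonneg y x l he hw hl' (hq' hyv)).update hrel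
  · intro y x l he hw hl hq ha
    obtain ⟨hl', hq'⟩ := hstay (K.fst_mem _ he) hl hq
    simp only [Finset.mem_insert, not_or] at ha
    exact (h.relaxed_neg y x l he hw hl' (hq' ha.1) ha.2).update hrel
  · exact fun y k r hy hk => (h.short y k r hy hk).update hrel
  · exact fun _ y x k r hy hk he hw => (h.short_neg hst y x k r hy hk he hw).update hrel
  · simp [hst]
  · simp [hst]
  · simp [hst]

theorem BFDInv.endDijkstra {st : BFDState X} (h : BFDInv K w aux s d st)
    (hst : st.status = .dijkstra) (hq : st.queue = ∅) :
    ∀ v k r, NegWalk K w s v k r → k < st.iter + 1 → LabelLE st.label v r := by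
  intro v k r hv
  induction hv with
  | nil => exact fun _ => h.source
  | nonneg x _ he hw ih =>
    intro hk
    obtain ⟨l, h1, h2⟩ := ih hk
    exact (h.relaxed_nonneg _ x l he hw h1 (by simp [hq])).mono (by linarith)
  | neg x hv he hw _ =>
    intro hk
    exact h.short_neg hst _ x _ _ hv (by omega) he hw

theorem BFDInv.bellmanFordPhase {st : BFDState X} (h : BFDInv K w aux s d st)
    (hst : st.status = .bellmanFord) :
    BFDInv K w aux s d (bellmanFordPhase K w aux st) := by
  have hrel := isRelaxation_bestNegRelaxation K w aux st
  have hq0 := (h.bellmanFord hst).1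
  have hbest : ∀ {v x l}, (v, x) ∈ K.edges → w v x < 0 → st.label v = some l →
      LabelLE (fun x => (bestNegRelaxation K w aux st x).or (st.label x)) x (l.len + w v x) := by
    intro v x l he hw hl
    by_cases ha : v ∈ st.active
    · exact labelLE_bestNegRelaxation_or h.active_isSome hl ha he hw
    · exact (h.relaxed_neg v x l he hw hl (by simp [hq0]) ha).update hrel
  have hstay : ∀ {y l}, y ∈ K.verts → (bestNegRelaxation K w aux st y).or (st.label y) = some l →
      y ∉ K.verts.filter (fun x => (bestNegRelaxation K w aux st x).isSome) →
      st.label y = some l := by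
    intro y l hy hl hq
    simp only [Finset.mem_filter, not_and] at hq
    have hn : bestNegRelaxation K w aux st y = none := by simpa using hq hy
    simpa [hn] using hl
  unfold _root_.bellmanFordPhase
  constructor
  · exact h.labels.update hrel
  · exact h.source.update hrel
  · intro q hq
    simp [(Finset.mem_filter.mp hq).2]
  · simp
  · simp
  · simp
  · intro y x l he hw hl hq
    exact (h.relaxed_nonneg y x l he hw (hstay (K.fst_mem _ he) hl hq) (by simp [hq0])).update hrel
  · intro y x l he hw hl hq _
    exact hbest he hw (hstay (K.fst_mem _ he) hl hq)
  · exact fun y k r hy hk => (h.short y k r hy hk).update hrel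
  · intro _ y x k r hy hk he hw
    obtain ⟨l, h1, h2⟩ := h.short y k r hy hk
    exact (hbest he hw h1).mono (by linarith)
  · intro hc
    dsimp only at hc
    split_ifs at hc
  · intro hc
    dsimp only at hc ⊢
    split_ifs at hc with hi
    exact ⟨hi, rfl⟩
  · intro x hc
    dsimp only at hc
    split_ifs at hc

theorem bfdStep_scan {st : BFDState X} (hst : st.status = .dijkstra) (hq : st.queue.Nonempty) :
    ∃ v ∈ st.queue, (∀ q ∈ st.queue, labelLen st.label v ≤ labelLen st.label q) ∧
      bfdStep K w aux d st = scanVertex K w aux st v := by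
  obtain ⟨h1, h2⟩ := (Finset.exists_min_image st.queue (labelLen st.label) hq).choose_spec
  exact ⟨_, h1, h2, by simp only [bfdStep, hst, hq, dite_true]⟩

theorem bfdStep_endDijkstra {st : BFDState X} (hst : st.status = .dijkstra) (hq : st.queue = ∅) :
    ∃ σ : BFDStatus X, bfdStep K w aux d st = { st with
        status := σ
        iter := st.iter + 1
        cost := st.cost + 1 + K.verts.card } ∧
      ((∃ x ∈ K.verts, (∃ l, st.label x = some l ∧ d < l.aux) ∧ σ = .found x) ∨
        (∀ x ∈ K.verts, ∀ l ∈ st.label x, l.aux ≤ d) ∧ σ = .bellmanFord) := by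
  refine ⟨if h' : ∃ x ∈ K.verts, ∃ l ∈ st.label x, d < l.aux then .found h'.choose
    else .bellmanFord, by simp only [bfdStep, hst, hq, Finset.not_nonempty_empty, dite_false], ?_⟩
  by_cases h' : ∃ x ∈ K.verts, ∃ l ∈ st.label x, d < l.aux
  · left
    obtain ⟨h1, l, h2, h3⟩ := h'.choose_spec
    exact ⟨_, h1, ⟨l, by simpa using h2, h3⟩, by simp only [h', dite_true]⟩
  · right
    refine ⟨?_, by simp only [h', dite_false]⟩
    push Not at h'
    exact h'

theorem BFDInv.bfdStep {st : BFDState X} (h : BFDInv K w aux s d st) :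
    BFDInv K w aux s d (bfdStep K w aux d st) := by
  cases hst : st.status with
  | done => simpa only [_root_.bfdStep, hst] using h
  | found x => simpa only [_root_.bfdStep, hst] using h
  | bellmanFord => simpa only [_root_.bfdStep, hst] using h.bellmanFordPhase hst
  | dijkstra =>
    rcases st.queue.eq_empty_or_nonempty with hq | hq
    · obtain ⟨σ, e, hσ⟩ := bfdStep_endDijkstra (K := K) (w := w) (aux := aux) (d := d) hst hq
      rw [e]
      refine ⟨h.labels, h.source, h.queue_isSome, h.active_isSome, h.disjoint, h.order,
        h.relaxed_nonneg, h.relaxed_neg, h.endDijkstra hst hq, ?_, ?_, ?_, ?_⟩ <;>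
      rcases hσ with ⟨x, hx, hl, rfl⟩ | ⟨hl, rfl⟩
      · simp
      · simp
      · simp
      · exact fun _ => ⟨hq, hl⟩
      · simp
      · simp
      · intro y hy
        obtain rfl : x = y := by simpa using hy
        exact ⟨hx, Nat.succ_pos _, hl⟩
      · simp
    · obtain ⟨v, hv, hmin, e⟩ := bfdStep_scan (K := K) (w := w) (aux := aux) (d := d) hst hq
      rw [e]
      exact (h.scanVertex hst hv hmin).1

/-! ### Running time of the hybrid -/

/-- An upper bound for the time spent in one iteration. -/
def iterCost (K : FinDigraph X) : ℕ :=
  (K.verts.card * extractCost K + K.edges.card) + (1 + K.verts.card) +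
    (1 + K.verts.card + K.edges.card)

theorem sum_outDeg_le (K : FinDigraph X) {A : Finset X} (hA : A ⊆ K.verts) :
    ∑ v ∈ A, outDeg K v ≤ K.edges.card := by
  calc ∑ v ∈ A, outDeg K v ≤ ∑ v ∈ K.verts, outDeg K v :=
        Finset.sum_le_sum_of_subset hA
    _ = K.edges.card := (Finset.card_eq_sum_card_fiberwise fun e he => K.fst_mem e he).symm

theorem sum_extractCost_le (K : FinDigraph X) {A : Finset X} (hA : A ⊆ K.verts) :
    ∑ v ∈ A, (extractCost K + outDeg K v) ≤ K.verts.card * extractCost K + K.edges.card := by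
  rw [Finset.sum_add_distrib, Finset.sum_const, smul_eq_mul]
  exact add_le_add (Nat.mul_le_mul_right _ (Finset.card_le_card hA)) (sum_outDeg_le K hA)

/-- The invariant for the running time: the time units spent so far are covered by `iterCost` for
each completed Dijkstra phase and by the extractions of the current one. -/
structure BFDCost (K : FinDigraph X) (st : BFDState X) : Prop where
  dijkstra : st.status = .dijkstra → st.cost ≤ K.verts.card + st.iter * iterCost K +
    ∑ v ∈ st.active, (extractCost K + outDeg K v)
  bellmanFord : st.status = .bellmanFord →
    st.cost + (1 + K.verts.card + K.edges.card) ≤ K.verts.card + st.iter * iterCost K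
  done : st.status = .done → st.cost ≤ K.verts.card + st.iter * iterCost K
  found : ∀ x, st.status = .found x → st.cost ≤ K.verts.card + st.iter * iterCost K

theorem BFDCost.bfdStep {st : BFDState X} (hc : BFDCost K st) (h : BFDInv K w aux s d st) :
    BFDCost K (bfdStep K w aux d st) := by
  have hact : st.active ⊆ K.verts := fun a ha => h.labels.mem_verts (h.active_isSome a ha)
  cases hst : st.status with
  | done => simpa only [_root_.bfdStep, hst] using hc
  | found x => simpa only [_root_.bfdStep, hst] using hc
  | bellmanFord =>
    simp only [_root_.bfdStep, hst, _root_.bellmanFordPhase]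
    have h1 := hc.bellmanFord hst
    have h2 := sum_outDeg_le K hact
    have h3 := Finset.card_le_card hact
    have h4 : st.cost + 1 + ∑ v ∈ st.active, (1 + outDeg K v) ≤
        K.verts.card + st.iter * iterCost K := by
      rw [Finset.sum_add_distrib, Finset.sum_const, smul_eq_mul, mul_one]
      omega
    exact ⟨fun _ => by simpa using h4, fun hs => by dsimp only at hs; split_ifs at hs,
      fun _ => h4, fun _ _ => h4⟩
  | dijkstra =>
    have h1 := hc.dijkstra hst
    rcases st.queue.eq_empty_or_nonempty with hq | hq
    · obtain ⟨σ, e, hσ⟩ := bfdStep_endDijkstra (K := K) (w := w) (aux := aux) (d := d) hst hq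
      rw [e]
      have h2 := sum_extractCost_le K hact
      have h3 : st.cost + 1 + K.verts.card + (1 + K.verts.card + K.edges.card) ≤
          K.verts.card + (st.iter + 1) * iterCost K := by
        rw [add_mul, one_mul, iterCost]
        rw [iterCost] at h1
        omega
      have h4 : st.cost + 1 + K.verts.card ≤ K.verts.card + (st.iter + 1) * iterCost K := by
        omega
      refine ⟨fun hs => ?_, fun _ => h3, fun _ => h4, fun _ _ => h4⟩
      rcases hσ with ⟨x, -, -, rfl⟩ | ⟨-, rfl⟩ <;> simp at hs
    · obtain ⟨v, hv, hmin, e⟩ := bfdStep_scan (K := K) (w := w) (aux := aux) (d := d) hst hq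
      rw [e]
      have hva := (h.scanVertex hst hv hmin).2
      refine ⟨fun _ => ?_, ?_, ?_, ?_⟩
      · simp only [_root_.scanVertex]
        rw [Finset.sum_insert hva]
        omega
      all_goals simp [_root_.scanVertex, hst]

theorem cost_lt_cost_bfdStep {st : BFDState X} (hd : st.status ≠ .done)
    (hf : ∀ x, st.status ≠ .found x) : st.cost < (bfdStep K w aux d st).cost := by
  cases hst : st.status with
  | done => exact absurd hst hd
  | found x => exact absurd hst (hf x)
  | bellmanFord =>
    simp only [bfdStep, hst, bellmanFordPhase]
    omega
  | dijkstra =>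
    rcases st.queue.eq_empty_or_nonempty with hq | hq
    · obtain ⟨σ, e, -⟩ := bfdStep_endDijkstra (K := K) (w := w) (aux := aux) (d := d) hst hq
      rw [e]
      dsimp only
      omega
    · obtain ⟨v, hv, hmin, e⟩ := bfdStep_scan (K := K) (w := w) (aux := aux) (d := d) hst hq
      rw [e]
      simp only [scanVertex, extractCost]
      omega

/-- Let `T` be such that some recorded walk is too long as soon as all walks with fewer than `T`
negative edges are accounted for, and let no labels be stable under relaxation.  Then the hybrid
terminates early, in one of the first `T` iterations. -/
theorem bfd_found (hs : s ∈ K.verts) (T : ℕ) (hT0 : 0 < T)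
    (hT : ∀ label, LabelInv K w aux s label →
      (∀ v k r, NegWalk K w s v k r → k < T → LabelLE label v r) →
      ∃ x ∈ K.verts, ∃ l ∈ label x, d < l.aux)
    (hstable : ∀ label, LabelInv K w aux s label → LabelLE label s 0 →
      ¬ ∀ v x l, (v, x) ∈ K.edges → label v = some l → LabelLE label x (l.len + w v x)) :
    (∀ k, BFDInv K w aux s d ((bfdStep K w aux d)^[k] (bfdInit K s))) ∧
    (∀ k, ((bfdStep K w aux d)^[k] (bfdInit K s)).iter ≤ T) ∧
    (∀ k, ((bfdStep K w aux d)^[k] (bfdInit K s)).cost ≤ K.verts.card + (T + 1) * iterCost K) ∧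
    ∃ k x, ((bfdStep K w aux d)^[k] (bfdInit K s)).status = .found x := by
  set run : ℕ → BFDState X := fun k => (bfdStep K w aux d)^[k] (bfdInit K s) with hrun
  have hsucc : ∀ k, run (k + 1) = bfdStep K w aux d (run k) :=
    fun k => Function.iterate_succ_apply' _ _ _
  have hinv : ∀ k, BFDInv K w aux s d (run k) := by
    intro k
    induction k with
    | zero => exact bfdInv_init hs
    | succ k ih => rw [hsucc]; exact ih.bfdStep
  have hcost : ∀ k, BFDCost K (run k) := by
    intro k
    induction k with
    | zero =>
      refine ⟨fun _ => ?_, ?_, ?_, ?_⟩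
      · simp [hrun, bfdInit]
      all_goals simp [hrun, bfdInit]
    | succ k ih => rw [hsucc]; exact ih.bfdStep (hinv k)
  have hdone : ∀ k, (run k).status ≠ .done := by
    intro k hk
    obtain ⟨h1, h2⟩ := (hinv k).done hk
    refine hstable _ (hinv k).labels (hinv k).source fun v x l he hl => ?_
    rcases le_or_gt 0 (w v x) with hw | hw
    · exact (hinv k).relaxed_nonneg v x l he hw hl (by simp [h1])
    · exact (hinv k).relaxed_neg v x l he hw hl (by simp [h1]) (by simp [h2])
  have hiter : ∀ k, (run k).iter ≤ T ∧ ((run k).iter = T → ∃ x, (run k).status = .found x) := by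
    intro k
    induction k with
    | zero => exact ⟨Nat.zero_le _, fun h => absurd h hT0.ne⟩
    | succ k ih =>
      rw [hsucc]
      cases hst : (run k).status with
      | done => exact absurd hst (hdone k)
      | found x => simpa only [bfdStep, hst] using ih
      | bellmanFord =>
        have hne : (run k).iter ≠ T := fun h => by obtain ⟨x, hx⟩ := ih.2 h; simp [hst] at hx
        simp only [bfdStep, hst, bellmanFordPhase]
        exact ⟨ih.1, fun h => absurd h hne⟩
      | dijkstra =>
        have hne : (run k).iter ≠ T := fun h => by obtain ⟨x, hx⟩ := ih.2 h; simp [hst] at hx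
        rcases (run k).queue.eq_empty_or_nonempty with hq | hq
        · obtain ⟨σ, e, hσ⟩ := bfdStep_endDijkstra (K := K) (w := w) (aux := aux) (d := d) hst hq
          rw [e]
          refine ⟨by dsimp only; omega, fun hTe => ?_⟩
          dsimp only at hTe ⊢
          rcases hσ with ⟨x, -, -, rfl⟩ | ⟨hle, rfl⟩
          · exact ⟨x, rfl⟩
          · obtain ⟨x, hx, l, hl, hd⟩ := hT _ (hinv k).labels
              (by rw [← hTe]; exact (hinv k).endDijkstra hst hq)
            exact absurd (hle x hx l hl) (not_le.mpr hd)
        · obtain ⟨v, hv, hmin, e⟩ := bfdStep_scan (K := K) (w := w) (aux := aux) (d := d) hst hq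
          rw [e]
          simp only [scanVertex]
          exact ⟨ih.1, fun h => absurd h hne⟩
  have hbound : ∀ k, (run k).cost ≤ K.verts.card + (T + 1) * iterCost K := by
    intro k
    have h1 : (run k).iter * iterCost K ≤ T * iterCost K := Nat.mul_le_mul_right _ (hiter k).1
    rw [add_mul, one_mul]
    cases hst : (run k).status with
    | done => exact absurd hst (hdone k)
    | found x => have := (hcost k).found x hst; omega
    | bellmanFord => have := (hcost k).bellmanFord hst; omega
    | dijkstra =>
      have h2 := (hcost k).dijkstra hst
      have h3 := sum_extractCost_le K (A := (run k).active)
        fun a ha => (hinv k).labels.mem_verts ((hinv k).active_isSome a ha)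
      have h4 : K.verts.card * extractCost K + K.edges.card ≤ iterCost K := by
        rw [iterCost]; omega
      omega
  refine ⟨hinv, fun k => (hiter k).1, hbound, ?_⟩
  by_contra hnf
  push Not at hnf
  -- as long as the run goes on, every step takes time, so that it cannot go on forever
  have hgrow : ∀ k, k ≤ (run k).cost := by
    intro k
    induction k with
    | zero => exact Nat.zero_le _
    | succ k ih =>
      have h1 := cost_lt_cost_bfdStep (K := K) (w := w) (aux := aux) (d := d) (hdone k)
        (fun x => hnf k x)
      rw [hsucc]
      omega
  have h1 := hgrow (K.verts.card + (T + 1) * iterCost K + 1)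
  have h2 := hbound (K.verts.card + (T + 1) * iterCost K + 1)
  omega

end Machine

/-! ### The graph with a source -/

theorem mem_withSource_none {H : FinDigraph V} {v : V} :
    (none, some v) ∈ (withSource H).edges ↔ v ∈ H.verts := by
  simp [withSource]

theorem mem_withSource_some {H : FinDigraph V} {u v : V} :
    (some u, some v) ∈ (withSource H).edges ↔ (u, v) ∈ H.edges := by
  simp [withSource]

theorem not_mem_withSource_none {H : FinDigraph V} {a : Option V} :
    (a, none) ∉ (withSource H).edges := by
  simp [withSource]

theorem some_mem_withSource_verts {H : FinDigraph V} {v : V} :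
    some v ∈ (withSource H).verts ↔ v ∈ H.verts := by
  simp [withSource]

theorem card_withSource_verts (H : FinDigraph V) :
    (withSource H).verts.card = H.verts.card + 1 := by
  simp only [withSource]
  rw [Finset.card_insert_of_notMem (by simp),
    Finset.card_image_of_injective _ (Option.some_injective V)]

theorem card_withSource_edges_le (H : FinDigraph V) :
    (withSource H).edges.card ≤ H.verts.card + H.edges.card :=
  (Finset.card_union_le _ _).trans (add_le_add Finset.card_image_le Finset.card_image_le)

/-- Apart from its first vertex, a walk from the source never visits the source. -/
theorem exists_eq_map_some_of_walkEdges {H : FinDigraph V} {a : Option V} {p : List (Option V)}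
    (hp : ∀ e ∈ walkEdges (a :: p), e ∈ (withSource H).edges) :
    ∃ q : List V, p = q.map some := by
  induction p generalizing a with
  | nil => exact ⟨[], rfl⟩
  | cons b p ih =>
    obtain ⟨q, rfl⟩ := ih (a := b) fun e he => hp e (by simp [he])
    have h1 := hp (a, b) (by simp)
    cases b with
    | none => exact absurd h1 not_mem_withSource_none
    | some b => exact ⟨b :: q, rfl⟩

theorem exists_walk_of_withSource {H : FinDigraph V} {v : V} {p : List (Option V)}
    (hp : IsWalkFromTo (withSource H) none (some v) p) :
    ∃ u q, p = none :: q.map some ∧ IsWalkFromTo H u v q := by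
  obtain ⟨⟨-, h2, h3⟩, h4, h5⟩ := hp
  obtain ⟨t, rfl⟩ := List.head?_eq_some_iff.mp h4
  obtain ⟨q, rfl⟩ := exists_eq_map_some_of_walkEdges h3
  cases q with
  | nil => simp at h5
  | cons u q =>
    refine ⟨u, u :: q, rfl, ⟨by simp, fun y hy => ?_, fun e he => ?_⟩, rfl, ?_⟩
    · exact some_mem_withSource_verts.mp
        (h2 (some y) (List.mem_cons_of_mem _ (List.mem_map_of_mem hy)))
    · refine mem_withSource_some.mp (h3 (some e.1, some e.2) ?_)
      rw [List.map_cons, walkEdges_cons_cons, ← List.map_cons, walkEdges_map]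
      exact List.mem_cons_of_mem _ (List.mem_map_of_mem (f := Prod.map some some) he)
    · rw [List.map_cons, List.getLast?_cons_cons, ← List.map_cons, List.getLast?_map] at h5
      simpa using h5

theorem walkWeight_sourceWt (w : V → V → ℝ) {q : List V} {u : V} (hq : q.head? = some u) :
    walkWeight (sourceWt w) (none :: q.map some) = walkWeight w q := by
  obtain ⟨t, rfl⟩ := List.head?_eq_some_iff.mp hq
  rw [List.map_cons, walkWeight_cons_cons, ← List.map_cons, walkWeight_map]
  simp [sourceWt]

theorem walkWeight_reweight_sourceWt (w : V → V → ℝ) (ψ : V → ℝ) {q : List V} {u v : V}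
    (hu : q.head? = some u) (hv : q.getLast? = some v) :
    walkWeight (reweight (sourceWt w) (sourcePot ψ)) (none :: q.map some) =
      walkWeight w q - ψ v := by
  rw [walkWeight_reweight (u := none) (v := some v) rfl, walkWeight_sourceWt w hu]
  · simp [sourcePot]
  · obtain ⟨t, rfl⟩ := List.head?_eq_some_iff.mp hu
    rw [List.map_cons, List.getLast?_cons_cons, ← List.map_cons, List.getLast?_map, hv]
    rfl

theorem hits_concat (S : Finset (V × V)) {P : List V} {v : V} (h : P.getLast? = some v) (x : V) :
    hits S (P ++ [x]) = hits S P + if (v, x) ∈ S then 1 else 0 := by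
  simp [hits, walkEdges_concat h, List.countP_append, List.countP_cons]

/-- If the edges outside `S` are non-negative after reweighting, then the negative edges of a walk
from the source are its first edge, possibly, and edges in `S`. -/
theorem exists_negWalk {H : FinDigraph V} {w : V → V → ℝ} {ψ : V → ℝ} {S : Finset (V × V)}
    (hψ : ∀ e ∈ H.edges \ S, 0 ≤ reweight w ψ e.1 e.2) {u v : V} {Q : List V}
    (hQ : IsWalkFromTo H u v Q) :
    ∃ k ≤ hits S Q + 1, NegWalk (withSource H) (reweight (sourceWt w) (sourcePot ψ)) none (some v)
      k (walkWeight w Q - ψ v) := by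
  induction Q using List.reverseRecOn generalizing v with
  | nil => exact absurd rfl hQ.1.1
  | append_singleton P x ih =>
    obtain rfl : x = v := by simpa using hQ.2.2
    rcases hl : P.getLast? with _ | y
    · obtain rfl : P = [] := by simpa using hl
      have he : (none, some x) ∈ (withSource H).edges :=
        mem_withSource_none.mpr (hQ.1.2 x (by simp))
      have e1 : walkWeight w ([] ++ [x]) - ψ x =
          0 + reweight (sourceWt w) (sourcePot ψ) none (some x) := by
        simp [reweight, sourceWt, sourcePot]
      rw [e1]
      rcases le_or_gt 0 (reweight (sourceWt w) (sourcePot ψ) none (some x)) with h0 | h0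
      · exact ⟨0, Nat.zero_le _, NegWalk.nil.nonneg _ he h0⟩
      · exact ⟨1, by simp, NegWalk.nil.neg _ he h0⟩
    · have hne : P ≠ [] := by rintro rfl; simp at hl
      have hP : IsWalkFromTo H u y P := by
        refine ⟨hQ.1.of_infix ⟨[], [x], rfl⟩ hne, ?_, hl⟩
        have h1 := hQ.2.1
        rwa [List.head?_append_of_ne_nil _ hne] at h1
      have he : (y, x) ∈ H.edges := hQ.1.3 _ (by simp [walkEdges_concat hl])
      obtain ⟨k, hk, hkw⟩ := ih hP
      have e1 : walkWeight w (P ++ [x]) - ψ x = walkWeight w P - ψ y +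
          reweight (sourceWt w) (sourcePot ψ) (some y) (some x) := by
        rw [walkWeight_concat w hl]
        simp only [reweight, sourceWt, sourcePot]
        ring
      rw [e1, hits_concat S hl]
      rcases le_or_gt 0 (reweight (sourceWt w) (sourcePot ψ) (some y) (some x)) with h0 | h0
      · exact ⟨k, by omega, hkw.nonneg _ (mem_withSource_some.mpr he) h0⟩
      · have hS : (y, x) ∈ S := by
          by_contra hS
          exact absurd (hψ (y, x) (Finset.mem_sdiff.mpr ⟨he, hS⟩)) (not_le.mpr h0)
        exact ⟨k + 1, by simp [hS]; omega, hkw.neg _ (mem_withSource_some.mpr he) h0⟩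

/-! ### Short walks in the presence of a negative cycle -/

/-- If all cycles without positive edges have weight `0`, then walks of bounded length in `H_{≥0}`
have bounded weight: a potential for the subgraph of the non-positive edges shows that the weight
can only drop by a bounded amount between two positive edges, each of which has a length bounded
from below. -/
theorem exists_lowerBound_walkWeight [Finite V] {H : FinDigraph V} {w : V → V → ℝ}
    (hnp : ¬ ∃ P, IsNegCycle H w P ∧ ∀ e ∈ walkEdges P, w e.1 e.2 ≤ 0) (d : ℝ) :
    ∃ B : ℝ, ∀ u v P, IsWalkFromTo H u v P → walkWeight (nonnegWt w) P ≤ d →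
      B ≤ walkWeight w P := by
  have := Fintype.ofFinite V
  let F : FinDigraph V :=
    { verts := H.verts
      edges := H.edges.filter fun e => w e.1 e.2 ≤ 0
      fst_mem := fun e he => H.fst_mem e (Finset.mem_filter.mp he).1
      snd_mem := fun e he => H.snd_mem e (Finset.mem_filter.mp he).1 }
  have hFv : F.verts ⊆ H.verts := fun v hv => hv
  have hFe : F.edges ⊆ H.edges := Finset.filter_subset _ _
  obtain ⟨ρ, hρ⟩ := exists_feasible_potential (K := F) (w := w) fun P hP => by
    by_contra hlt
    exact hnp ⟨P, ⟨⟨hP.1.mono hFv hFe, hP.2⟩, not_le.mp hlt⟩,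
      fun e he => (Finset.mem_filter.mp (hP.1.3 e he)).2⟩
  set M : ℝ := ∑ x, |ρ x| with hM
  have hM0 : 0 ≤ M := Finset.sum_nonneg fun _ _ => abs_nonneg _
  have hρM : ∀ x, |ρ x| ≤ M := fun x =>
    Finset.single_le_sum (f := fun x => |ρ x|) (fun _ _ => abs_nonneg _) (Finset.mem_univ x)
  set T : ℝ := ∑ e ∈ H.edges.filter (fun e => 0 < w e.1 e.2), 2 * M / w e.1 e.2 with hT
  have hterm : ∀ e ∈ H.edges.filter (fun e => 0 < w e.1 e.2), 0 ≤ 2 * M / w e.1 e.2 :=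
    fun e he => div_nonneg (by linarith) (Finset.mem_filter.mp he).2.le
  have hT0 : 0 ≤ T := Finset.sum_nonneg hterm
  refine ⟨-(2 * M) - T * d, fun u v P hP hd => ?_⟩
  have key := potential_le_add_walkWeight (f := ρ) (w := fun a b => w a b + T * nonnegWt w a b)
    hP.2.1 hP.2.2 fun e he => ?_
  · rw [walkWeight_add, walkWeight_mul_left] at key
    have h1 := abs_le.mp (hρM u)
    have h2 := abs_le.mp (hρM v)
    have h3 := mul_le_mul_of_nonneg_left hd hT0
    linarith
  · have heH := hP.1.3 e he
    rcases le_or_gt (w e.1 e.2) 0 with h0 | h0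
    · have h1 := hρ e (Finset.mem_filter.mpr ⟨heH, h0⟩)
      simpa [nonnegWt, h0] using h1
    · have h1 := abs_le.mp (hρM e.1)
      have h2 := abs_le.mp (hρM e.2)
      have h3 : 2 * M / w e.1 e.2 ≤ T :=
        Finset.single_le_sum hterm (Finset.mem_filter.mpr ⟨heH, h0⟩)
      rw [div_le_iff₀ h0] at h3
      simp only [nonnegWt, max_eq_left h0.le]
      linarith

/-- Among the walks of length at most `d` in `H_{≥0}`, consider the infimum of the weights for
each endpoint.  These infima are not a feasible potential, because of the negative cycle: some
walk `Q` of length at most `d` can be extended by an edge `(x, y)` to a walk that is lighter than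
all walks of length at most `d` to `y`. -/
theorem exists_improving_edge [Finite V] {H : FinDigraph V} {w : V → V → ℝ} {d : ℝ} (hd : 0 ≤ d)
    (hnp : ¬ ∃ P, IsNegCycle H w P ∧ ∀ e ∈ walkEdges P, w e.1 e.2 ≤ 0)
    (hneg : ∃ P, IsNegCycle H w P) :
    ∃ x y u Q, (x, y) ∈ H.edges ∧ IsWalkFromTo H u x Q ∧ walkWeight (nonnegWt w) Q ≤ d ∧
      ∀ u' P, IsWalkFromTo H u' y P → walkWeight (nonnegWt w) P ≤ d →
        walkWeight w Q + w x y < walkWeight w P := by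
  obtain ⟨B, hB⟩ := exists_lowerBound_walkWeight hnp d
  let A : V → Set ℝ := fun y =>
    {r | ∃ u P, IsWalkFromTo H u y P ∧ walkWeight (nonnegWt w) P ≤ d ∧ walkWeight w P = r}
  have hbdd : ∀ y, BddBelow (A y) := fun y => ⟨B, by
    rintro r ⟨u, P, h1, h2, rfl⟩
    exact hB u y P h1 h2⟩
  have hne : ∀ y ∈ H.verts, (A y).Nonempty := fun y hy =>
    ⟨0, y, [y], isWalk_singleton hy, by simpa using hd, by simp⟩
  obtain ⟨Γ, ⟨hΓ, hlen, hclosed⟩, hΓneg⟩ := hneg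
  obtain ⟨a, t, rfl⟩ := List.exists_cons_of_ne_nil hΓ.1
  set n : ℝ := (((a :: t).length - 1 : ℕ) : ℝ) with hn
  have hn0 : 0 < n := by
    rw [hn, Nat.cast_pos]
    omega
  set ε : ℝ := -walkWeight w (a :: t) / (2 * n) with hε
  have hε0 : 0 < ε := div_pos (by linarith) (by linarith)
  obtain ⟨e, he, hlt⟩ : ∃ e ∈ walkEdges (a :: t),
      sInf (A e.1) + (w e.1 e.2 + ε) < sInf (A e.2) := by
    by_contra hcon
    push Not at hcon
    have h1 := potential_le_add_walkWeight (f := fun y => sInf (A y)) (w := fun x y => w x y + ε)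
      (P := a :: t) (u := a) (v := a) rfl (by rw [← hclosed]; rfl) hcon
    rw [walkWeight_add, walkWeight_const, ← hn] at h1
    have h2 : n * ε = -walkWeight w (a :: t) / 2 := by
      rw [hε]; field_simp
    linarith
  have heH := hΓ.3 e he
  obtain ⟨r, ⟨u, Q, hQ, hQd, rfl⟩, hr⟩ :=
    exists_lt_of_csInf_lt (hne e.1 (H.fst_mem e heH)) (lt_add_of_pos_right (sInf (A e.1)) hε0)
  refine ⟨e.1, e.2, u, Q, heH, hQ, hQd, fun u' P hP hPd => ?_⟩
  have h3 : sInf (A e.2) ≤ walkWeight w P := csInf_le (hbdd e.2) ⟨u', P, hP, hPd, rfl⟩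
  linarith

/-! ### The hybrid on a graph with a negative cycle -/

/-- The run of the hybrid when `(x, y)` is an edge as in `exists_improving_edge`: once the walks
with at most `hits S Q + 2` negative edges are accounted for, the distance of `y` is smaller than
the weight of every walk of length at most `d`, so that the recorded walk is longer. -/
theorem bfdRun_found {H : FinDigraph V} {w : V → V → ℝ} {ψ : V → ℝ} {d : ℝ}
    {S : Finset (V × V)} (hd : 0 < d) (hψ : ∀ e ∈ H.edges \ S, 0 ≤ reweight w ψ e.1 e.2)
    (hneg : ∃ P, IsNegCycle H w P) {x y u : V} {Q : List V} (hxy : (x, y) ∈ H.edges)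
    (hQ : IsWalkFromTo H u x Q)
    (himp : ∀ u' P, IsWalkFromTo H u' y P → walkWeight (nonnegWt w) P ≤ d →
        walkWeight w Q + w x y < walkWeight w P) :
    (∀ k, (bfdRun H w ψ d k).iter ≤ hits S Q + 3) ∧
    (∀ k, (bfdRun H w ψ d k).cost ≤
      (withSource H).verts.card + (hits S Q + 4) * iterCost (withSource H)) ∧
    ∃ (k : ℕ) (u v : V) (l : BFDLabel (Option V)),
      (bfdRun H w ψ d k).status = BFDStatus.found (some v) ∧
      (bfdRun H w ψ d k).label (some v) = some l ∧
      IsWalkFromTo H u v l.path ∧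
      d < walkWeight (nonnegWt w) l.path ∧
      ((∀ x ∈ H.verts, ψ x ≤ 0) → walkWeight w l.path ≤ 0) ∧
      ∀ a B, a :: (B ++ [a]) <:+: l.path → walkWeight w (a :: (B ++ [a])) < 0 := by
  set rw' := reweight (sourceWt w) (sourcePot ψ) with hrw
  have hdecode : ∀ {label v l}, LabelInv (withSource H) rw' (sourceWt (nonnegWt w)) none label →
      label (some v) = some l → ∃ u q, l.rpath.reverse = none :: q.map some ∧
        IsWalkFromTo H u v q ∧ l.len = walkWeight w q - ψ v ∧
        l.aux = walkWeight (nonnegWt w) q := by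
    intro label v l hinv hl
    obtain ⟨u, q, h1, h2⟩ := exists_walk_of_withSource (hinv.walk hl)
    refine ⟨u, q, h1, h2, ?_, ?_⟩
    · rw [hinv.len_eq hl, h1, hrw, walkWeight_reweight_sourceWt w ψ h2.2.1 h2.2.2]
    · rw [hinv.aux_eq hl, h1, walkWeight_sourceWt _ h2.2.1]
  obtain ⟨hinv, hiter, hcost, k, z, hk⟩ := bfd_found (K := withSource H) (w := rw')
    (aux := sourceWt (nonnegWt w)) (s := none) (d := d) (by simp [withSource]) (hits S Q + 3)
    (by omega)
    (by
      intro label hlab hshort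
      by_contra hcon
      push Not at hcon
      obtain ⟨k, hk, hkw⟩ := exists_negWalk hψ hQ
      have he : (some x, some y) ∈ (withSource H).edges := mem_withSource_some.mpr hxy
      have hle : LabelLE label (some y) (walkWeight w Q - ψ x + rw' (some x) (some y)) := by
        rcases le_or_gt 0 (rw' (some x) (some y)) with h0 | h0
        · exact hshort _ k _ (hkw.nonneg _ he h0) (by omega)
        · exact hshort _ (k + 1) _ (hkw.neg _ he h0) (by omega)
      obtain ⟨l, hl, hle⟩ := hle
      obtain ⟨u', q, h1, h2, h3, h4⟩ := hdecode hlab hl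
      have h5 := hcon (some y) (some_mem_withSource_verts.mpr (H.snd_mem _ hxy)) l (by simp [hl])
      have h6 := himp u' q h2 (h4 ▸ h5)
      simp only [hrw, reweight, sourceWt, sourcePot] at hle
      linarith)
    (by
      intro label hlab hsrc hstable
      obtain ⟨l₀, hl₀, -⟩ := hsrc
      obtain ⟨Γ, ⟨hΓ, hlen, hclosed⟩, hΓneg⟩ := hneg
      obtain ⟨a, t, rfl⟩ := List.exists_cons_of_ne_nil hΓ.1
      have hlast : (a :: t).getLast? = some a := by rw [← hclosed]; rfl
      have h1 := potential_le_add_walkWeight (f := fun v => labelLen label (some v))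
        (w := reweight w ψ) (P := a :: t) (u := a) (v := a) rfl hlast (fun e he => ?_)
      · rw [walkWeight_reweight (u := a) (v := a) rfl hlast] at h1
        linarith
      · have heH := hΓ.3 e he
        obtain ⟨l₁, hl₁, -⟩ := hstable none (some e.1) l₀
          (mem_withSource_none.mpr (H.fst_mem e heH)) hl₀
        obtain ⟨l₂, hl₂, h2⟩ := hstable (some e.1) (some e.2) l₁
          (mem_withSource_some.mpr heH) hl₁
        rw [labelLen_eq hl₁, labelLen_eq hl₂]
        exact h2)
  refine ⟨hiter, hcost, ?_⟩
  obtain ⟨hz, hpos, l, hl, hlt⟩ := (hinv k).found z hk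
  cases z with
  | none =>
    -- the only walk from the source to itself is trivial
    have hw := (hinv k).labels.walk hl
    obtain ⟨t, ht⟩ := List.head?_eq_some_iff.mp hw.2.1
    have h3 := hw.1.3
    rw [ht] at h3
    obtain ⟨q, rfl⟩ := exists_eq_map_some_of_walkEdges h3
    have haux := (hinv k).labels.aux_eq hl
    rcases List.eq_nil_or_concat q with rfl | ⟨q, b, rfl⟩
    · rw [ht] at haux
      simp at haux
      linarith
    · have h4 := hw.2.2
      rw [ht] at h4
      simp [List.getLast?_cons] at h4
  | some v =>
    obtain ⟨u', q, h1, h2, h3, h4⟩ := hdecode (hinv k).labels hl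
    have hpath : l.path = q := by
      rw [BFDLabel.path, h1]
      simp [List.reduceOption]
    refine ⟨k, u', v, l, hk, hl, hpath ▸ h2, by rw [hpath, ← h4]; exact hlt, fun hψ0 => ?_, ?_⟩
    · have hv := some_mem_withSource_verts.mp hz
      have h0 : 0 ≤ rw' none (some v) := by
        simpa [hrw, reweight, sourceWt, sourcePot] using hψ0 v hv
      obtain ⟨l', hl', hle⟩ := (hinv k).short (some v) 0 _
        (NegWalk.nil.nonneg (some v) (mem_withSource_none.mpr hv) h0) hpos
      obtain rfl : l = l' := by
        have := hl.symm.trans hl'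
        simpa using this
      rw [hpath]
      simp only [hrw, reweight, sourceWt, sourcePot] at hle
      linarith
    · intro a B hB
      rw [hpath] at hB
      have h5 := (hinv k).labels.closed_neg hl (some a) (B.map some) (by
        rw [h1]
        have := (hB.map (some : V → Option V)).trans
          (List.suffix_cons (none : Option V) (q.map some)).isInfix
        simpa using this)
      have e1 : some a :: (B.map some ++ [some a]) = (a :: (B ++ [a])).map some := by simp
      rw [hrw, walkWeight_reweight (u := some a) (v := some a) rfl (by simp [List.getLast?_cons]),
        e1, walkWeight_map] at h5
      simpa [sourceWt] using h5

/-! ### Weights in the scaled graph -/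

theorem walkWeight_scaledWt {wG : V → V → ℤ} {W : ℝ} (P : List V) : walkWeight (scaledWt wG W) P =
    walkWeight (fun a b => (wG a b : ℝ)) P + (P.length - 1 : ℕ) * (W / 2) := by
  rw [← walkWeight_const, ← walkWeight_add]
  rfl

theorem walkWeight_le_scaledWt {wG : V → V → ℤ} {W : ℝ} (hW : 0 < W) (P : List V) :
    walkWeight (fun a b => (wG a b : ℝ)) P ≤ walkWeight (scaledWt wG W) P := by
  rw [walkWeight_scaledWt]
  have : (0 : ℝ) ≤ (P.length - 1 : ℕ) * (W / 2) := by positivity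
  linarith

/-- Negative edges of `G'` weigh at least `-W / 2`, so many edges are needed to make up for the
length in `G'_{≥0}` of a walk of non-positive weight. -/
theorem lt_length_of_walkWeight_nonpos {E : Finset (V × V)} {wG : V → V → ℤ} {W d : ℝ}
    (hE : ∀ e ∈ E, -W ≤ (wG e.1 e.2 : ℝ)) (hW : 0 < W) {P : List V}
    (hPE : ∀ e ∈ walkEdges P, e ∈ E)
    (hd : d < walkWeight (nonnegWt (scaledWt wG W)) P)
    (h0 : walkWeight (scaledWt wG W) P ≤ 0) : d < (P.length - 1 : ℕ) * (W / 2) := by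
  have h1 : walkWeight (nonnegWt (scaledWt wG W)) P ≤
      walkWeight (fun a b => scaledWt wG W a b + W / 2) P := by
    refine walkWeight_mono fun e he => ?_
    have := hE e (hPE e he)
    simp only [nonnegWt, scaledWt]
    exact max_le (by linarith) (by linarith)
  rw [walkWeight_add, walkWeight_const] at h1
  linarith

/-! ### The decomposition tree -/

theorem scc_verts_subset (H : FinDigraph V) (S : Finset (V × V)) (v : V) :
    (scc H S v).verts ⊆ H.verts :=
  Finset.filter_subset _ _

theorem scc_edges_subset (H : FinDigraph V) (S : Finset (V × V)) (v : V) :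
    (scc H S v).edges ⊆ H.edges :=
  (Finset.filter_subset _ _).trans Finset.sdiff_subset

theorem reach_of_walkEdges {F : Finset (V × V)} {P : List V} {u v : V}
    (hF : ∀ e ∈ walkEdges P, e ∈ F) (hu : P.head? = some u) (hv : P.getLast? = some v) :
    Reach F u v := by
  induction P generalizing u with
  | nil => simp at hu
  | cons a P ih =>
    obtain rfl : a = u := by simpa using hu
    cases P with
    | nil =>
      obtain rfl : a = v := by simpa using hv
      exact Relation.ReflTransGen.refl
    | cons b P =>
      exact Relation.ReflTransGen.head (hF (a, b) (by simp))
        (ih (fun e he => hF e (by simp [he])) rfl (by simpa [List.getLast?_cons_cons] using hv))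

/-- A cycle that avoids `S` lies in a strongly connected component of `H ∖ S`. -/
theorem IsCycle.exists_scc {H : FinDigraph V} {S : Finset (V × V)} {P : List V}
    (hP : IsCycle H P) (hS : ∀ e ∈ walkEdges P, e ∉ S) :
    ∃ a ∈ H.verts, IsCycle (scc H S a) P := by
  obtain ⟨hw, hlen, hclosed⟩ := hP
  obtain ⟨a, t, rfl⟩ := List.exists_cons_of_ne_nil hw.1
  have hlast : (a :: t).getLast? = some a := by rw [← hclosed]; rfl
  have hF : ∀ e ∈ walkEdges (a :: t), e ∈ H.edges \ S := fun e he =>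
    Finset.mem_sdiff.mpr ⟨hw.3 e he, hS e he⟩
  have hverts : ∀ b ∈ a :: t, b ∈ (scc H S a).verts := by
    intro b hb
    obtain ⟨A, B, hAB⟩ := List.append_of_mem hb
    refine Finset.mem_filter.mpr ⟨hw.2 b hb, ?_, ?_⟩
    · refine reach_of_walkEdges (P := A ++ [b]) (fun e he => hF e ?_) ?_ (by simp)
      · rw [hAB, walkEdges_glue]
        exact List.mem_append_left _ he
      · cases A with
        | nil => simpa using (congrArg List.head? hAB).symm
        | cons x A => simpa using (congrArg List.head? hAB).symm
    · refine reach_of_walkEdges (P := b :: B) (fun e he => hF e ?_) rfl ?_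
      · rw [hAB, walkEdges_glue]
        exact List.mem_append_right _ he
      · rw [hAB, List.getLast?_append_of_ne_nil _ (by simp)] at hlast
        exact hlast
  refine ⟨a, hw.2 a (by simp), ⟨hw.1, hverts, fun e he => ?_⟩, hlen, hclosed⟩
  exact Finset.mem_filter.mpr ⟨hF e he, hverts _ (List.of_mem_zip he).1,
    hverts _ (List.mem_of_mem_tail (List.of_mem_zip he).2)⟩

theorem childParam_le {H C : FinDigraph V} {d : ℝ} (hd : 0 < d) : childParam H C d ≤ d := by
  unfold childParam
  split_ifs <;> linarith

/-- Two balls that both contain more than half of the vertices meet. -/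
theorem exists_walk_of_balls {H : FinDigraph V} {w : V → V → ℝ} {r : ℝ} {x y : V}
    (hx : H.verts.card < 2 * (outBall H w x r).card)
    (hy : H.verts.card < 2 * (inBall H w y r).card) :
    ∃ R, IsWalkFromTo H x y R ∧ walkWeight w R ≤ 2 * r := by
  obtain ⟨z, hz⟩ := Finset.inter_nonempty_of_card_lt_card_add_card
    (t := outBall H w x r) (u := inBall H w y r)
    (Finset.filter_subset _ _) (Finset.filter_subset _ _) (by omega)
  obtain ⟨h1, h2⟩ := Finset.mem_inter.mp hz
  obtain ⟨-, P, hP, hPr⟩ := Finset.mem_filter.mp h1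
  obtain ⟨-, Q, hQ, hQr⟩ := Finset.mem_filter.mp h2
  exact ⟨_, hP.append_tail hQ, by rw [walkWeight_append_tail w hP hQ]; linarith⟩

section Tree

variable [Fintype V] {E : Finset (V × V)} {W : ℝ} {σ : Outcome V} {H : FinDigraph V} {d : ℝ}

theorem IsInternalNode.edges_subset (h : IsInternalNode E W σ H d) : H.edges ⊆ E := by
  induction h with
  | root => exact Finset.Subset.refl _
  | child H d v _ _ _ ih => exact (scc_edges_subset _ _ _).trans ih

theorem IsInternalNode.param_eq_or_lt (h : IsInternalNode E W σ H d) :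
    d = rootParam V W ∨ W / 2 < d := by
  cases h with
  | root => exact Or.inl rfl
  | child H d v _ _ hd => exact Or.inr hd

theorem IsInternalNode.param_pos (h : IsInternalNode E W σ H d) (hW : 0 < W)
    (hH : H.verts.Nonempty) : 0 < d := by
  rcases h.param_eq_or_lt with rfl | h
  · obtain ⟨v, -⟩ := hH
    have : 0 < Fintype.card V := Fintype.card_pos_iff.mpr ⟨v⟩
    have : (0 : ℝ) < Fintype.card V := by exact_mod_cast this
    rw [rootParam]
    positivity
  · linarith

/-- The call at a node does not influence the part of the tree above this node. -/
theorem IsInternalNode.update (h : IsInternalNode E W σ H d) (hW : 0 < W)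
    (S : Finset (V × V)) : IsInternalNode E W (Function.update σ (H, d) S) H d := by
  have key : ∀ K r, IsInternalNode E W σ K r → H.verts.card ≤ K.verts.card → d ≤ r →
      IsInternalNode E W (Function.update σ (H, d) S) K r := by
    intro K r hK
    induction hK with
    | root => exact fun _ _ => IsInternalNode.root
    | child K r v hK hv hr ih =>
      intro h1 h2
      have hr0 := hK.param_pos hW ⟨v, hv⟩
      have h3 := Finset.card_le_card (scc_verts_subset K (σ (K, r)) v)
      have h4 := childParam_le (H := K) (C := scc K (σ (K, r)) v) hr0
      have hne : (K, r) ≠ (H, d) := by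
        -- a child is smaller than its parent in one of the two parameters
        intro heq
        obtain ⟨rfl, rfl⟩ := Prod.mk.inj heq
        have hpos : 0 < K.verts.card := Finset.card_pos.mpr ⟨v, hv⟩
        unfold childParam at h2
        split_ifs at h2 with hc
        · omega
        · linarith
      have h5 := ih (h1.trans h3) (h2.trans h4)
      have h6 := IsInternalNode.child (σ := Function.update σ (H, d) S) K r v h5 hv
      rw [Function.update_of_ne hne] at h6
      exact h6 hr
  exact key H d h le_rfl le_rfl

/-- Only positive edges are ever removed, so a negative cycle without positive edges survives
down to a leaf. -/
theorem caughtAtLeaf_of_isNegCycle {w : V → V → ℝ} (hW : 0 < W)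
    (hσ : ∀ K r, IsInternalNode E W σ K r → K.verts.Nonempty → ∀ e ∈ σ (K, r), 0 < w e.1 e.2)
    (h : IsInternalNode E W σ H d)
    (hP : ∃ P, IsNegCycle H w P ∧ ∀ e ∈ walkEdges P, w e.1 e.2 ≤ 0) :
    CaughtAtLeaf E w W σ := by
  obtain ⟨P, ⟨hcyc, hneg⟩, hle⟩ := hP
  have key : ∀ (N k : ℕ) (H : FinDigraph V) (d : ℝ), IsInternalNode E W σ H d → IsCycle H P →
      d ≤ 2 ^ k * (W / 2) → H.verts.card + k < N → CaughtAtLeaf E w W σ := by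
    intro N
    induction N with
    | zero => intro k H d _ _ _ hN; omega
    | succ N ih =>
      intro k H d hH hcyc hd hN
      have hne : H.verts.Nonempty := by
        obtain ⟨a, t, rfl⟩ := List.exists_cons_of_ne_nil hcyc.1.1
        exact ⟨a, hcyc.1.2 a (by simp)⟩
      obtain ⟨a, ha, hcyc'⟩ := hcyc.exists_scc (S := σ (H, d)) fun e he heS =>
        absurd (hσ H d hH hne e heS) (not_lt.mpr (hle e he))
      by_cases hleaf : childParam H (scc H (σ (H, d)) a) d ≤ W / 2
      · refine ⟨_, ⟨H, d, a, hH, ha, rfl, hleaf⟩, ?_⟩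
        by_contra hcon
        push Not at hcon
        exact absurd (walkWeight_nonneg fun e he => hcon e (hcyc'.1.3 e he)) (not_le.mpr hneg)
      · have hchild := IsInternalNode.child H d a hH ha (not_le.mp hleaf)
        have hcard := Finset.card_le_card (scc_verts_subset H (σ (H, d)) a)
        have hpos : 0 < H.verts.card := Finset.card_pos.mpr hne
        by_cases hc : 4 * (scc H (σ (H, d)) a).verts.card ≤ 3 * H.verts.card
        · have e : childParam H (scc H (σ (H, d)) a) d = d := by simp [childParam, hc]
          rw [e] at hchild
          exact ih k _ _ hchild hcyc' hd (by omega)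
        · have e : childParam H (scc H (σ (H, d)) a) d = d / 2 := by simp [childParam, hc]
          rw [e] at hchild hleaf
          cases k with
          | zero => exact absurd (by linarith) hleaf
          | succ k => exact ih k _ _ hchild hcyc' (by rw [pow_succ] at hd; linarith) (by omega)
  obtain ⟨k, hk⟩ := pow_unbounded_of_one_lt (d / (W / 2)) (one_lt_two (α := ℝ))
  rw [div_lt_iff₀ (by linarith)] at hk
  exact key _ k H d h hcyc hk.le (Nat.lt_succ_self _)

/-! ### Closing walks to negative cycles -/

theorem isWalkFromTo_rootGraph (hE : H.edges ⊆ E) {u v : V} {P : List V}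
    (h : IsWalkFromTo H u v P) : IsWalkFromTo (rootGraph E) u v P :=
  h.mono (Finset.subset_univ _) hE

variable {wG : V → V → ℤ}

theorem closesToNegCycle (hW : 0 < W) {u v : V} {P R : List V} {r : ℝ}
    (hP : IsWalkFromTo (rootGraph E) u v P) (hlen : 2 ≤ P.length)
    (hR : IsWalkFromTo (rootGraph E) v u R) (hRr : walkWeight (nonnegWt (scaledWt wG W)) R ≤ r)
    (hPr : walkWeight (fun a b => (wG a b : ℝ)) P < -r) : ClosesToNegCycle E wG W u v P := by
  refine ⟨exists_isShortestWalk (fun P _ => walkWeight_nonnegWt_nonneg _ P) hR,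
    fun P' hP' => ?_⟩
  have hc := hP.append_tail hP'.1
  refine ⟨⟨hc.1, by simp; omega, by rw [hc.2.1, hc.2.2]⟩, ?_⟩
  rw [walkWeight_append_tail _ hP hP'.1]
  have h1 := hP'.2 R hR
  have h2 := walkWeight_le_nonnegWt (scaledWt wG W) P'
  have h3 := walkWeight_le_scaledWt (wG := wG) hW P'
  linarith

theorem closesToNegCycle_of_leaf (hW : 0 < W) (hprog : AllProgress E (scaledWt wG W) W σ)
    {K : FinDigraph V} (hK : IsLeaf E W σ K) {e : V × V} (he : e ∈ K.edges)
    (hneg : scaledWt wG W e.1 e.2 < 0) : ClosesToNegCycle E wG W e.1 e.2 [e.1, e.2] := by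
  obtain ⟨H, d, v, hH, hv, rfl, hleaf⟩ := hK
  have hsub := hH.edges_subset
  have heE : e ∈ E := hsub (scc_edges_subset _ _ _ he)
  have h1 := FinDigraph.fst_mem _ e he
  have h2 := FinDigraph.snd_mem _ e he
  have hwalk : IsWalkFromTo (rootGraph E) e.1 e.2 [e.1, e.2] :=
    ⟨⟨by simp, fun _ _ => Finset.mem_univ _, fun e' he' => by
      obtain rfl : e' = e := by simpa using he'
      exact heE⟩, rfl, rfl⟩
  have hwt : walkWeight (fun a b => (wG a b : ℝ)) [e.1, e.2] < -(W / 2) := by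
    simp only [scaledWt] at hneg
    simp only [walkWeight_cons_cons, walkWeight_singleton]
    linarith
  by_cases hc : 4 * (scc H (σ (H, d)) v).verts.card ≤ 3 * H.verts.card
  · -- this would be a leaf below a root with a single vertex, but then the child is not smaller
    exfalso
    have hd : d ≤ W / 2 := by simpa [childParam, hc] using hleaf
    have hn : Fintype.card V ≤ 1 := by
      rcases hH.param_eq_or_lt with rfl | h
      · by_contra hcon
        have : (2 : ℝ) ≤ Fintype.card V := by exact_mod_cast not_le.mp hcon
        rw [rootParam] at hd
        nlinarith
      · linarith
    have h3 : 0 < (scc H (σ (H, d)) v).verts.card := Finset.card_pos.mpr ⟨_, h1⟩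
    have h4 : H.verts.card ≤ Fintype.card V := Finset.card_le_univ _
    omega
  · have hd : d / 2 ≤ W / 2 := by simpa [childParam, hc] using hleaf
    have hballs := (hprog H d hH v hv).resolve_left hc
    obtain ⟨R, hR, hRd⟩ := exists_walk_of_balls (hballs _ h2).1 (hballs _ h1).2
    exact closesToNegCycle hW hwalk (by simp) (isWalkFromTo_rootGraph hsub hR)
      (by linarith) hwt

/-- Below the first halving of the diameter parameter, all vertices of a node `(H, d)` have
distance at most `d` from each other in `G'_{≥0}`. -/
theorem IsInternalNode.exists_walk {w : V → V → ℝ} (h : IsInternalNode E W σ H d)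
    (hprog : AllProgress E w W σ) : d = rootParam V W ∨
      ∀ x ∈ H.verts, ∀ y ∈ H.verts, ∃ R, IsWalkFromTo (rootGraph E) x y R ∧
        walkWeight (nonnegWt w) R ≤ d := by
  induction h with
  | root => exact Or.inl rfl
  | child H d v hH hv hr ih =>
    by_cases hc : 4 * (scc H (σ (H, d)) v).verts.card ≤ 3 * H.verts.card
    · have e : childParam H (scc H (σ (H, d)) v) d = d := by simp [childParam, hc]
      rw [e]
      exact ih.imp id fun h x hx y hy =>
        h x (scc_verts_subset _ _ _ hx) y (scc_verts_subset _ _ _ hy)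
    · have e : childParam H (scc H (σ (H, d)) v) d = d / 2 := by simp [childParam, hc]
      rw [e]
      right
      intro x hx y hy
      have hballs := (hprog H d hH v hv).resolve_left hc
      obtain ⟨R, hR, hRd⟩ := exists_walk_of_balls (hballs _ hx).1 (hballs _ hy).2
      exact ⟨R, isWalkFromTo_rootGraph hH.edges_subset hR, by linarith⟩

theorem closesToNegCycle_of_long_walk (hE : ∀ e ∈ E, -W ≤ (wG e.1 e.2 : ℝ)) (hW : 0 < W)
    (hH : IsInternalNode E W σ H d) (hprog : AllProgress E (scaledWt wG W) W σ)
    (hroot : d < rootParam V W) {u v : V} {P : List V} (hP : IsWalkFromTo H u v P)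
    (hd : d < walkWeight (nonnegWt (scaledWt wG W)) P)
    (h0 : walkWeight (scaledWt wG W) P ≤ 0) : ClosesToNegCycle E wG W u v P := by
  have hu : u ∈ H.verts := hP.1.2 u (List.mem_of_head? hP.2.1)
  have hv : v ∈ H.verts := hP.1.2 v (List.mem_of_getLast? hP.2.2)
  obtain ⟨R, hR, hRd⟩ := ((hH.exists_walk hprog).resolve_left hroot.ne) v hv u hu
  have h1 := lt_length_of_walkWeight_nonpos hE hW
    (fun e he => hH.edges_subset (hP.1.3 e he)) hd h0
  have h2 := walkWeight_scaledWt (wG := wG) (W := W) P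
  refine closesToNegCycle hW (isWalkFromTo_rootGraph hH.edges_subset hP) ?_ hR hRd (by linarith)
  by_contra hlen
  have h3 : P.length - 1 = 0 := by omega
  have h4 := hH.param_pos hW ⟨u, hu⟩
  rw [h3, Nat.cast_zero, zero_mul] at h1
  linarith

/-- At diameter parameter `n W / 2` the walk has more than `n` edges, hence visits some vertex
twice. -/
theorem exists_isNegCycle_of_long_walk (hE : ∀ e ∈ E, -W ≤ (wG e.1 e.2 : ℝ)) (hW : 0 < W)
    (hsub : H.edges ⊆ E) {P : List V} (hP : IsWalk H P)
    (hd : rootParam V W < walkWeight (nonnegWt (scaledWt wG W)) P)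
    (h0 : walkWeight (scaledWt wG W) P ≤ 0)
    (hclosed : ∀ a B, a :: (B ++ [a]) <:+: P →
      walkWeight (scaledWt wG W) (a :: (B ++ [a])) < 0) :
    ∃ Q, Q <:+: P ∧ IsNegCycle H (scaledWt wG W) Q ∧
      IsNegCycle (rootGraph E) (fun a b => (wG a b : ℝ)) Q := by
  have h1 := lt_length_of_walkWeight_nonpos hE hW (fun e he => hsub (hP.3 e he)) hd h0
  have hnd : ¬ P.Nodup := by
    intro hnd
    have h2 : ((P.length - 1 : ℕ) : ℝ) ≤ Fintype.card V := by
      exact_mod_cast (Nat.sub_le _ _).trans hnd.length_le_card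
    rw [rootParam] at h1
    nlinarith
  obtain ⟨A, a, B, C, rfl⟩ := List.exists_eq_of_not_nodup hnd
  have hinf : a :: (B ++ [a]) <:+: A ++ a :: (B ++ a :: C) := ⟨A, C, by simp⟩
  have hcyc := isCycle_of_infix hP hinf
  have hneg := hclosed a B hinf
  exact ⟨_, hinf, ⟨hcyc, hneg⟩, ⟨⟨hcyc.1.mono (Finset.subset_univ _) hsub, hcyc.2⟩,
    (walkWeight_le_scaledWt hW _).trans_lt hneg⟩⟩

end Tree

/-! ### Expectations over finite laws -/

theorem PMF.sum_bind_mul {α β : Type*} [Fintype α] [Fintype β] (p : PMF α) (f : α → PMF β)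
    (g : β → ENNReal) : ∑ b, (p.bind f) b * g b = ∑ a, p a * ∑ b, f a b * g b := by
  simp only [PMF.bind_apply, tsum_fintype, Finset.sum_mul, Finset.mul_sum]
  rw [Finset.sum_comm]
  simp only [mul_assoc]

theorem PMF.sum_map_mul {α β : Type*} [Fintype α] [Fintype β] (p : PMF α) (f : α → β)
    (g : β → ENNReal) : ∑ b, (p.map f) b * g b = ∑ a, p a * g (f a) := by
  rw [PMF.map, PMF.sum_bind_mul]
  simp [PMF.pure_apply]

theorem PMF.sum_eq_one {α : Type*} [Fintype α] (p : PMF α) : ∑ a, p a = 1 := by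
  simpa only [tsum_fintype] using p.tsum_coe

theorem PMF.sum_mul_le_sum_mul {α : Type*} [Fintype α] (p : PMF α) {f g : α → ENNReal}
    (h : ∀ a ∈ p.support, f a ≤ g a) : ∑ a, p a * f a ≤ ∑ a, p a * g a := by
  refine Finset.sum_le_sum fun a _ => ?_
  by_cases ha : a ∈ p.support
  · gcongr
    exact h a ha
  · rw [PMF.mem_support_iff, not_not] at ha
    simp [ha]

/-! ### Ball carving -/

/-- A random set `B` of vertices around `v` with at most half of the vertices of `H`.  It is an
out-ball or an in-ball: `src` and `dst` tell the direction in which the edges are followed, and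
the edges with `src e ∈ B` and `dst e ∉ B` are to be cut.  An edge is cut with a probability that
is, up to the small error `ε`, proportional to its length and to the probability that the ball
reaches the edge. -/
structure IsCarver [Fintype V] (w : V → V → ℝ) (H : FinDigraph V) (Λ ε : ENNReal) (v : V)
    (p : PMF (Finset V)) (src dst : V × V → V) : Prop where
  dir : (src = Prod.fst ∧ dst = Prod.snd) ∨ (src = Prod.snd ∧ dst = Prod.fst)
  mem : ∀ B ∈ p.support, v ∈ B
  small : ∀ B ∈ p.support, 2 * B.card ≤ H.verts.card
  pos : ∀ B ∈ p.support, ∀ e ∈ H.edges, src e ∈ B → dst e ∉ B → 0 < w e.1 e.2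
  prob : ∀ e ∈ H.edges, ∑ B, p B * (if src e ∈ B ∧ dst e ∉ B then 1 else 0) ≤
    ENNReal.ofReal (nonnegWt w e.1 e.2) * Λ * (∑ B, p B * (if src e ∈ B then 1 else 0) + ε)

/-- The edges in `F` connect the vertices of `C` strongly within `C`: no subset of `C` is left
without an outgoing edge. -/
def StronglyConnectedOn (F : Finset (V × V)) (C : Finset V) : Prop :=
  ∀ p : V → Prop, ∀ a ∈ C, ∀ b ∈ C, p a → ¬ p b → ∃ x ∈ C, ∃ y ∈ C, (x, y) ∈ F ∧ p x ∧ ¬ p y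

theorem stronglyConnectedOn_scc (H : FinDigraph V) (S : Finset (V × V)) (v : V) :
    StronglyConnectedOn (H.edges \ S) (scc H S v).verts := by
  intro p a ha b hb hpa hpb
  obtain ⟨-, hva, -⟩ := Finset.mem_filter.mp ha
  obtain ⟨-, -, hbv⟩ := Finset.mem_filter.mp hb
  obtain ⟨-, -, hav⟩ := Finset.mem_filter.mp ha
  have hvb := (Finset.mem_filter.mp hb).2.1
  have hab : Reach (H.edges \ S) a b := hav.trans hvb
  clear hb hvb
  induction hab with
  | refl => exact absurd hpa hpb
  | @tail x y hax hxy ih =>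
    have hxyH := (Finset.mem_sdiff.mp hxy).1
    have hyC : y ∈ (scc H S v).verts :=
      Finset.mem_filter.mpr ⟨H.snd_mem _ hxyH, (hva.trans hax).tail hxy, hbv⟩
    have hxC : x ∈ (scc H S v).verts :=
      Finset.mem_filter.mpr ⟨H.fst_mem _ hxyH, hva.trans hax, hbv.head hxy⟩
    by_cases hpx : p x
    · exact ⟨x, hxC, y, hyC, hxy, hpx, hpb⟩
    · exact ih hpx (hbv.head hxy)

/-- Carving random balls around the vertices in `L`, one after the other, out of the set `U`.
A strongly connected part of the remaining graph either lies in one of the balls, so that it has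
at most half of the vertices, or avoids all vertices in `L`.  Once a ball touches an edge, later
balls do not cut the edge any more; this is why the probabilities add up to only
`Λ (1 + |L| ε)` times the length of the edge. -/
theorem exists_carving [Fintype V] {w : V → V → ℝ} {H : FinDigraph V} {Λ ε : ENNReal}
    (L : List V) (hL : ∀ v ∈ L, ∃ p src dst, IsCarver w H Λ ε v p src dst) (U : Finset V) :
    ∃ law : PMF (Finset (V × V)),
      (∀ S ∈ law.support, ∀ e ∈ S, e ∈ H.edges ∧ 0 < w e.1 e.2 ∧ e.1 ∈ U ∧ e.2 ∈ U) ∧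
      (∀ S ∈ law.support, ∀ C ⊆ U, StronglyConnectedOn (H.edges \ S) C →
        2 * C.card ≤ H.verts.card ∨ ∀ v ∈ L, v ∉ C) ∧
      ∀ e ∈ H.edges, ∑ S, law S * (if e ∈ S then 1 else 0) ≤
        ENNReal.ofReal (nonnegWt w e.1 e.2) * Λ * (1 + L.length * ε) := by
  induction L generalizing U with
  | nil =>
    refine ⟨PMF.pure ∅, ?_, ?_, ?_⟩
    · simp
    · simp
    · intro e _
      rw [Finset.sum_eq_zero]
      · exact zero_le
      · intro S _
        by_cases hS : S = ∅ <;> simp [PMF.pure_apply, hS]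
  | cons v L ih =>
    obtain ⟨p, src, dst, hp⟩ := hL v (by simp)
    have hIH := fun B : Finset V => ih (fun x hx => hL x (List.mem_cons_of_mem _ hx)) (U \ B)
    choose lawB h1 h2 h3 using hIH
    let cut : Finset V → Finset (V × V) := fun B =>
      H.edges.filter fun e => (e.1 ∈ U ∧ e.2 ∈ U) ∧ src e ∈ B ∧ dst e ∉ B
    have hsupp : ∀ S ∈ (p.bind fun B => (lawB B).map fun S' => cut B ∪ S').support,
        ∃ B ∈ p.support, ∃ S' ∈ (lawB B).support, S = cut B ∪ S' := by
      intro S hS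
      obtain ⟨B, hB, hS⟩ := (PMF.mem_support_bind_iff _ _ _).mp hS
      obtain ⟨S', hS', rfl⟩ := (PMF.mem_support_map_iff _ _ _).mp hS
      exact ⟨B, hB, S', hS', rfl⟩
    refine ⟨p.bind fun B => (lawB B).map fun S' => cut B ∪ S', ?_, ?_, ?_⟩
    · intro S hS e he
      obtain ⟨B, hB, S', hS', rfl⟩ := hsupp S hS
      rcases Finset.mem_union.mp he with he | he
      · obtain ⟨k1, k2, k3, k4⟩ := Finset.mem_filter.mp he
        exact ⟨k1, hp.pos B hB e k1 k3 k4, k2⟩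
      · obtain ⟨k1, k2, k3, k4⟩ := h1 B S' hS' e he
        exact ⟨k1, k2, (Finset.mem_sdiff.mp k3).1, (Finset.mem_sdiff.mp k4).1⟩
    · intro S hS C hCU hC
      obtain ⟨B, hB, S', hS', rfl⟩ := hsupp S hS
      have hcross : ∀ x ∈ C, ∀ y ∈ C, (x, y) ∈ H.edges \ (cut B ∪ S') →
          ¬ (src (x, y) ∈ B ∧ dst (x, y) ∉ B) := by
        intro x hx y hy hxy hc
        obtain ⟨k1, k2⟩ := Finset.mem_sdiff.mp hxy
        exact k2 (Finset.mem_union_left _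
          (Finset.mem_filter.mpr ⟨k1, ⟨hCU hx, hCU hy⟩, hc⟩))
      have hall : (∀ x ∈ C, x ∈ B) ∨ ∀ x ∈ C, x ∉ B := by
        by_contra hcon
        push Not at hcon
        obtain ⟨⟨b, hb, hbB⟩, a, ha, haB⟩ := hcon
        rcases hp.dir with ⟨rfl, rfl⟩ | ⟨rfl, rfl⟩
        · obtain ⟨x, hx, y, hy, hxy, k1, k2⟩ := hC (fun z => z ∈ B) a ha b hb haB hbB
          exact hcross x hx y hy hxy ⟨k1, k2⟩
        · obtain ⟨x, hx, y, hy, hxy, k1, k2⟩ :=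
            hC (fun z => z ∉ B) b hb a ha hbB (not_not.mpr haB)
          exact hcross x hx y hy hxy ⟨not_not.mp k2, k1⟩
      rcases hall with hall | hall
      · left
        have := Finset.card_le_card (show C ⊆ B from hall)
        have := hp.small B hB
        omega
      · have hC' : StronglyConnectedOn (H.edges \ S') C := by
          intro q a ha b hb hqa hqb
          obtain ⟨x, hx, y, hy, hxy, k⟩ := hC q a ha b hb hqa hqb
          exact ⟨x, hx, y, hy, Finset.sdiff_subset_sdiff subset_rfl
            Finset.subset_union_right hxy, k⟩
        refine (h2 B S' hS' C
          (fun x hx => Finset.mem_sdiff.mpr ⟨hCU hx, hall x hx⟩) hC').imp id fun h x hx => ?_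
        rcases List.mem_cons.mp hx with rfl | hx
        · exact fun hxC => hall x hxC (hp.mem B hB)
        · exact h x hx
    · intro e he
      rw [PMF.sum_bind_mul]
      simp only [PMF.sum_map_mul]
      set b := ENNReal.ofReal (nonnegWt w e.1 e.2) * Λ with hb
      have hinner : ∀ B, ∑ S', lawB B S' * (if e ∈ cut B ∪ S' then 1 else 0) ≤
          (if src e ∈ B ∧ dst e ∉ B then 1 else 0) +
            (if src e ∈ B then 0 else 1) * (b * (1 + L.length * ε)) := by
        intro B
        by_cases hs : src e ∈ B
        · by_cases hd : dst e ∈ B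
          · -- an edge inside the ball is never cut
            have hzero : ∀ S' ∈ (lawB B).support,
                (if e ∈ cut B ∪ S' then (1 : ENNReal) else 0) ≤ 0 := by
              intro S' hS'
              rw [if_neg]
              intro hmem
              rcases Finset.mem_union.mp hmem with hmem | hmem
              · exact (Finset.mem_filter.mp hmem).2.2.2 hd
              · obtain ⟨-, -, k3, k4⟩ := h1 B S' hS' e hmem
                rw [Finset.mem_sdiff] at k3 k4
                rcases hp.dir with ⟨rfl, rfl⟩ | ⟨rfl, rfl⟩
                · exact k3.2 hs
                · exact k4.2 hs
            refine ((lawB B).sum_mul_le_sum_mul hzero).trans ?_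
            simp
          · simp only [hs, hd, not_false_eq_true, and_self, if_true]
            refine le_add_right ?_
            calc _ ≤ ∑ S', lawB B S' * 1 := by
                  gcongr with S'
                  split_ifs <;> simp
              _ = 1 := by simp [PMF.sum_eq_one]
        · simp only [hs, false_and, if_false, zero_add, one_mul]
          refine le_trans (Finset.sum_le_sum fun S' _ => ?_) (h3 B e he)
          have : e ∉ cut B := fun hmem => hs (Finset.mem_filter.mp hmem).2.2.1
          simp [Finset.mem_union, this]
      have hsum : ∑ B, p B * (if src e ∈ B then (1 : ENNReal) else 0) +
          ∑ B, p B * (if src e ∈ B then 0 else 1) = 1 := by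
        rw [← Finset.sum_add_distrib]
        refine Eq.trans ?_ p.sum_eq_one
        refine Finset.sum_congr rfl fun B _ => ?_
        split_ifs <;> simp
      set t := ∑ B, p B * (if src e ∈ B then (1 : ENNReal) else 0) with ht
      set t' := ∑ B, p B * (if src e ∈ B then (0 : ENNReal) else 1) with ht'
      have ht1 : t' ≤ 1 := by rw [← hsum]; exact le_add_self
      calc _ ≤ ∑ B, p B * ((if src e ∈ B ∧ dst e ∉ B then 1 else 0) +
            (if src e ∈ B then 0 else 1) * (b * (1 + L.length * ε))) := by
            gcongr with B
            exact hinner B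
        _ = ∑ B, p B * (if src e ∈ B ∧ dst e ∉ B then 1 else 0) +
            t' * (b * (1 + L.length * ε)) := by
            simp only [mul_add, Finset.sum_add_distrib, ht', Finset.sum_mul, mul_assoc]
        _ ≤ b * (t + ε) + t' * (b * (1 + L.length * ε)) := by
            gcongr
            exact hp.prob e he
        _ = b * (t + t' + ε + t' * (L.length * ε)) := by ring
        _ ≤ b * (1 + ε + 1 * (L.length * ε)) := by
            rw [hsum]
            gcongr
        _ = b * (1 + (v :: L).length * ε) := by
            push_cast [List.length_cons]
            ring

/-! ### Balls with truncated geometric radii -/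

/-- Let `A` hold from some index `j₀` on, and `A'` from `j₀ + m` on at the latest.  Then the
indices with `A` but not `A'` carry a share of at most `m (1 - q)` of the geometric weight of the
indices with `A`, up to the weight lost by the truncation at `M`. -/
theorem sum_geometric_le {q : ℝ} (hq0 : 0 < q) (hq1 : q < 1) (M m : ℕ) {A A' : ℕ → Prop}
    [DecidablePred A] [DecidablePred A']
    (hA : ∀ i j, i ≤ j → A i → A j) (hA' : ∀ i j, i ≤ j → A' i → A' j)
    (hm : ∀ i, A i → A' (i + m)) :
    ∑ j ∈ Finset.range M, (if A j ∧ ¬ A' j then q ^ j else 0) ≤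
      m * (1 - q) * (∑ j ∈ Finset.range M, (if A j then q ^ j else 0) + q ^ M / (1 - q)) := by
  have h1q : 0 < 1 - q := by linarith
  by_cases hex : ∃ j < M, A j
  · have hex' : ∃ j, A j := hex.imp fun _ h => h.2
    set j₀ := Nat.find hex' with hj₀
    have hj₀A : A j₀ := Nat.find_spec hex'
    have hj₀M : j₀ ≤ M := by
      obtain ⟨j, hj, hjA⟩ := hex
      exact (Nat.find_min' hex' hjA).trans hj.le
    have hiff : ∀ j, A j ↔ j₀ ≤ j := fun j =>
      ⟨fun h => Nat.find_min' hex' h, fun h => hA _ _ h hj₀A⟩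
    have e1 : ∑ j ∈ Finset.range M, (if A j then q ^ j else 0) = (q ^ j₀ - q ^ M) / (1 - q) := by
      have e2 : (Finset.range M).filter (fun j => A j) = Finset.Ico j₀ M := by
        ext j
        simp only [Finset.mem_filter, Finset.mem_range, Finset.mem_Ico, hiff]
        tauto
      rw [← Finset.sum_filter, e2, geom_sum_Ico hq1.ne hj₀M, ← neg_div_neg_eq]
      congr 1 <;> ring
    have e3 : m * (1 - q) * ((q ^ j₀ - q ^ M) / (1 - q) + q ^ M / (1 - q)) = m * q ^ j₀ := by
      field_simp
      ring
    rw [e1, e3, ← Finset.sum_filter]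
    have hsub : (Finset.range M).filter (fun j => A j ∧ ¬ A' j) ⊆ Finset.Ico j₀ (j₀ + m) := by
      intro j hj
      obtain ⟨-, k1, k2⟩ := Finset.mem_filter.mp hj
      refine Finset.mem_Ico.mpr ⟨(hiff j).mp k1, ?_⟩
      by_contra hcon
      exact k2 (hA' _ _ (not_lt.mp hcon) (hm _ hj₀A))
    calc _ ≤ ∑ j ∈ Finset.Ico j₀ (j₀ + m), q ^ j :=
          Finset.sum_le_sum_of_subset_of_nonneg hsub fun _ _ _ => by positivity
      _ ≤ ∑ j ∈ Finset.Ico j₀ (j₀ + m), q ^ j₀ :=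
          Finset.sum_le_sum fun j hj =>
            pow_le_pow_of_le_one hq0.le hq1.le (Finset.mem_Ico.mp hj).1
      _ = m * q ^ j₀ := by simp
  · push Not at hex
    have hz : ∑ j ∈ Finset.range M, (if A j ∧ ¬ A' j then q ^ j else 0) = 0 :=
      Finset.sum_eq_zero fun j hj => if_neg fun h => hex j (Finset.mem_range.mp hj) h.1
    rw [hz]
    have : 0 ≤ ∑ j ∈ Finset.range M, (if A j then q ^ j else 0) :=
      Finset.sum_nonneg fun j _ => by split_ifs <;> positivity
    positivity

theorem sum_ofReal_mul_ite {ι : Type*} [Fintype ι] {f : ι → ℝ} (hf : ∀ i, 0 ≤ f i)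
    (A : ι → Prop) [DecidablePred A] : ∑ i, ENNReal.ofReal (f i) * (if A i then 1 else 0) =
      ENNReal.ofReal (∑ i, if A i then f i else 0) := by
  rw [ENNReal.ofReal_sum_of_nonneg fun i _ => by split_ifs <;> simp [hf]]
  refine Finset.sum_congr rfl fun i _ => ?_
  split_ifs <;> simp

/-- A growing family of balls, of radii `0, δ, 2δ, …`, yields a carver: the index is drawn from
the geometric distribution with ratio `q`, truncated at `M`.  The radii are discrete; as no
positive weight is smaller than `δ`, rounding up the length of an edge to a multiple of `δ` at
most doubles it. -/
theorem exists_isCarver [Fintype V] {w : V → V → ℝ} {H : FinDigraph V} {v : V} {q δ : ℝ}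
    (hq0 : 0 < q) (hq1 : q < 1) (hδ : 0 < δ) {M : ℕ} (hM : 0 < M) {ball : ℕ → Finset V}
    {src dst : V × V → V}
    (hdir : (src = Prod.fst ∧ dst = Prod.snd) ∨ (src = Prod.snd ∧ dst = Prod.fst))
    (hmono : Monotone ball) (hmem : ∀ j, v ∈ ball j)
    (hsmall : ∀ j < M, 2 * (ball j).card ≤ H.verts.card)
    (hδw : ∀ e ∈ H.edges, 0 < w e.1 e.2 → δ ≤ w e.1 e.2)
    (hstep : ∀ e ∈ H.edges, ∀ j m : ℕ, nonnegWt w e.1 e.2 ≤ δ * m → src e ∈ ball j →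
      dst e ∈ ball (j + m)) :
    ∃ p, IsCarver w H (ENNReal.ofReal (2 * (1 - q) / δ)) (ENNReal.ofReal (q ^ M / (1 - q ^ M))) v
      p src dst := by
  have h1q : 0 < 1 - q := by linarith
  have hqM : q ^ M < 1 := pow_lt_one₀ hq0.le hq1 hM.ne'
  have h1qM : 0 < 1 - q ^ M := by linarith
  set Z : ℝ := (1 - q ^ M) / (1 - q) with hZ
  have hZ0 : 0 < Z := by positivity
  have hZsum : ∑ j ∈ Finset.range M, q ^ j = Z := by
    rw [geom_sum_eq hq1.ne, hZ, ← neg_div_neg_eq]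
    congr 1 <;> ring
  have hf0 : ∀ j : Fin M, 0 ≤ q ^ (j : ℕ) / Z := fun j => by positivity
  let p₀ : PMF (Fin M) := PMF.ofFintype (fun j => ENNReal.ofReal (q ^ (j : ℕ) / Z)) (by
    rw [← ENNReal.ofReal_sum_of_nonneg fun j _ => hf0 j, ← Finset.sum_div,
      Fin.sum_univ_eq_sum_range (fun j => q ^ j), hZsum, div_self hZ0.ne', ENNReal.ofReal_one])
  have hexp : ∀ (A : Finset V → Prop) [DecidablePred A],
      ∑ B, (p₀.map fun j : Fin M => ball j) B * (if A B then 1 else 0) =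
        ENNReal.ofReal ((∑ j ∈ Finset.range M, if A (ball j) then q ^ j else 0) / Z) := by
    intro A _
    rw [PMF.sum_map_mul]
    change ∑ j : Fin M, ENNReal.ofReal (q ^ (j : ℕ) / Z) * (if A (ball j) then 1 else 0) = _
    rw [sum_ofReal_mul_ite hf0, ← Fin.sum_univ_eq_sum_range
      (fun j => if A (ball j) then q ^ j else 0), Finset.sum_div]
    congr 1
    refine Finset.sum_congr rfl fun j _ => ?_
    split_ifs <;> simp
  have hsupp : ∀ B ∈ (p₀.map fun j : Fin M => ball j).support, ∃ j < M, B = ball j := by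
    intro B hB
    obtain ⟨j, -, rfl⟩ := (PMF.mem_support_map_iff _ _ _).mp hB
    exact ⟨j, j.2, rfl⟩
  refine ⟨p₀.map fun j : Fin M => ball j, hdir, ?_, ?_, ?_, ?_⟩
  · intro B hB
    obtain ⟨j, -, rfl⟩ := hsupp B hB
    exact hmem j
  · intro B hB
    obtain ⟨j, hj, rfl⟩ := hsupp B hB
    exact hsmall j hj
  · intro B hB e he hs hd
    obtain ⟨j, -, rfl⟩ := hsupp B hB
    by_contra hw
    exact hd (hstep e he j 0 (by simp [nonnegWt, not_lt.mp hw]) hs)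
  · intro e he
    rw [hexp (fun B => src e ∈ B ∧ dst e ∉ B), hexp (fun B => src e ∈ B)]
    set ℓ := nonnegWt w e.1 e.2 with hℓ
    have hℓ0 : 0 ≤ ℓ := le_max_right _ _
    set m := ⌈ℓ / δ⌉₊ with hm
    have hmℓ : (m : ℝ) * (1 - q) ≤ ℓ * (2 * (1 - q) / δ) := by
      have h1 : (m : ℝ) ≤ 2 * (ℓ / δ) := by
        rcases le_or_gt (w e.1 e.2) 0 with h0 | h0
        · have : ℓ = 0 := max_eq_right h0
          simp [hm, this]
        · have h2 : ℓ = w e.1 e.2 := max_eq_left h0.le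
          have h3 : 1 ≤ ℓ / δ := by
            rw [le_div_iff₀ hδ, one_mul, h2]
            exact hδw e he h0
          have h4 := Nat.ceil_lt_add_one (div_nonneg hℓ0 hδ.le)
          linarith
      calc (m : ℝ) * (1 - q) ≤ 2 * (ℓ / δ) * (1 - q) := by gcongr
        _ = ℓ * (2 * (1 - q) / δ) := by ring
    have hgeo := sum_geometric_le hq0 hq1 M m (A := fun j => src e ∈ ball j)
      (A' := fun j => dst e ∈ ball j) (fun i j hij h => hmono hij h)
      (fun i j hij h => hmono hij h)
      (fun i hi => hstep e he i m (by
        have := Nat.le_ceil (ℓ / δ)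
        rw [div_le_iff₀ hδ] at this
        rw [mul_comm]
        exact this) hi)
    set X := ∑ j ∈ Finset.range M, (if src e ∈ ball j then q ^ j else 0) with hX
    have hX0 : 0 ≤ X := Finset.sum_nonneg fun j _ => by split_ifs <;> positivity
    rw [← ENNReal.ofReal_mul hℓ0, ← ENNReal.ofReal_add (by positivity) (by positivity),
      ← ENNReal.ofReal_mul (by positivity)]
    refine ENNReal.ofReal_le_ofReal ?_
    rw [div_le_iff₀ hZ0]
    refine hgeo.trans ?_
    have e1 : ℓ * (2 * (1 - q) / δ) * (X / Z + q ^ M / (1 - q ^ M)) * Z =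
        ℓ * (2 * (1 - q) / δ) * (X + q ^ M / (1 - q)) := by
      rw [mul_assoc, add_mul, div_mul_cancel₀ _ hZ0.ne', hZ]
      congr 2
      field_simp
    rw [e1]
    gcongr

/-! ### Existence of decompositions -/

theorem isWalkFromTo_edge {H : FinDigraph V} {e : V × V} (he : e ∈ H.edges) :
    IsWalkFromTo H e.1 e.2 [e.1, e.2] :=
  (isWalk_singleton (H.fst_mem e he)).concat he

theorem outBall_step {H : FinDigraph V} {w : V → V → ℝ} {v : V} {r r' : ℝ} {e : V × V}
    (he : e ∈ H.edges) (hr : r + w e.1 e.2 ≤ r') (h : e.1 ∈ outBall H w v r) :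
    e.2 ∈ outBall H w v r' := by
  obtain ⟨-, P, hP, hPr⟩ := Finset.mem_filter.mp h
  refine Finset.mem_filter.mpr ⟨H.snd_mem e he, _, hP.concat he, ?_⟩
  rw [walkWeight_concat w hP.2.2]
  linarith

theorem inBall_step {H : FinDigraph V} {w : V → V → ℝ} {v : V} {r r' : ℝ} {e : V × V}
    (he : e ∈ H.edges) (hr : r + w e.1 e.2 ≤ r') (h : e.2 ∈ inBall H w v r) :
    e.1 ∈ inBall H w v r' := by
  obtain ⟨-, P, hP, hPr⟩ := Finset.mem_filter.mp h
  refine Finset.mem_filter.mpr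
    ⟨H.fst_mem e he, _, (isWalkFromTo_edge he).append_tail hP, ?_⟩
  rw [walkWeight_append_tail w (isWalkFromTo_edge he) hP]
  simp only [walkWeight_cons_cons, walkWeight_singleton]
  linarith

theorem outBall_mono {H : FinDigraph V} {w : V → V → ℝ} {v : V} {r r' : ℝ} (h : r ≤ r') :
    outBall H w v r ⊆ outBall H w v r' :=
  Finset.monotone_filter_right _ fun _ _ ⟨P, hP, hPr⟩ => ⟨P, hP, hPr.trans h⟩

theorem inBall_mono {H : FinDigraph V} {w : V → V → ℝ} {v : V} {r r' : ℝ} (h : r ≤ r') :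
    inBall H w v r ⊆ inBall H w v r' :=
  Finset.monotone_filter_right _ fun _ _ ⟨P, hP, hPr⟩ => ⟨P, hP, hPr.trans h⟩

theorem exists_pos_le_weights (w : V → V → ℝ) (H : FinDigraph V) :
    ∃ μ > 0, ∀ e ∈ H.edges, 0 < w e.1 e.2 → μ ≤ w e.1 e.2 := by
  rcases (H.edges.filter fun e => 0 < w e.1 e.2).eq_empty_or_nonempty with h | h
  · exact ⟨1, one_pos, fun e he hw => absurd
      (h ▸ Finset.mem_filter.mpr ⟨he, hw⟩ : e ∈ (∅ : Finset (V × V)))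
      (Finset.notMem_empty e)⟩
  · obtain ⟨e₀, he₀, hmin⟩ := Finset.exists_min_image _ (fun e : V × V => w e.1 e.2) h
    exact ⟨_, (Finset.mem_filter.mp he₀).2, fun e he hw =>
      hmin e (Finset.mem_filter.mpr ⟨he, hw⟩)⟩

theorem sum_mul_hits [Fintype V] (law : PMF (Finset (V × V))) (P : List V) :
    ∑ S, law S * (hits S P : ENNReal) =
      ((walkEdges P).map fun e => ∑ S, law S * (if e ∈ S then 1 else 0)).sum := by
  unfold hits
  induction walkEdges P with
  | nil => simp
  | cons e l ih =>
    rw [List.map_cons, List.sum_cons, ← ih, ← Finset.sum_add_distrib]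
    refine Finset.sum_congr rfl fun S _ => ?_
    rw [List.countP_cons, ← mul_add]
    congr 1
    push_cast
    rw [add_comm]
    simp

/-- Carving balls around all vertices one of whose balls of radius `d / 4` is not large.  The
progress property then holds with certainty.  With radii of `M` steps, the ratio
`q = exp (-log (2 N) / M)` makes the truncation error `1 / (2 N - 1)`, so that all at most `N`
balls together contribute a factor of at most `2`. -/
theorem exists_isDecomposition [Fintype V] {κ : ℝ} (w : V → V → ℝ) (H : FinDigraph V) {d : ℝ}
    {N : ℕ} (hd : 0 < d) (hN : H.verts.card ≤ N) :
    ∃ law : PMF (Finset (V × V)), IsDecomposition 32 κ N w H d law := by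
  have hprogress : ∀ law : PMF (Finset (V × V)), (∀ S ∈ law.support, Progress w H d S) →
      (∑ S : Finset (V × V), if Progress w H d S then 0 else law S) ≤
        ENNReal.ofReal ((N : ℝ) ^ (-κ)) := by
    intro law h
    rw [Finset.sum_eq_zero]
    · exact zero_le
    · intro S _
      by_cases hS : S ∈ law.support
      · simp [h S hS]
      · rw [PMF.mem_support_iff, not_not] at hS
        simp [hS]
  have hself : ∀ x ∈ H.verts, ∀ r : ℝ, 0 ≤ r → x ∈ outBall H (nonnegWt w) x r ∧
      x ∈ inBall H (nonnegWt w) x r := fun x hx r hr =>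
    ⟨Finset.mem_filter.mpr ⟨hx, [x], isWalk_singleton hx, by simpa using hr⟩,
      Finset.mem_filter.mpr ⟨hx, [x], isWalk_singleton hx, by simpa using hr⟩⟩
  rcases Nat.lt_or_ge N 2 with hN2 | hN2
  · refine ⟨PMF.pure ∅, ?_, hprogress _ ?_, ?_⟩
    · simp
    · intro S _ v _
      right
      intro x hx
      have hxH := scc_verts_subset _ _ _ hx
      have h1 := Finset.card_pos.mpr ⟨x, (hself x hxH (d / 4) (by linarith)).1⟩
      have h2 := Finset.card_pos.mpr ⟨x, (hself x hxH (d / 4) (by linarith)).2⟩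
      omega
    · intro P _ _
      rw [Finset.sum_eq_zero]
      · exact zero_le
      · intro S _
        by_cases hS : S = ∅ <;> simp [PMF.pure_apply, hits, hS]
  have hN2' : (2 : ℝ) ≤ N := by exact_mod_cast hN2
  obtain ⟨μ, hμ, hμw⟩ := exists_pos_le_weights w H
  obtain ⟨M, hM⟩ := exists_nat_gt (d / 4 / μ)
  have hM0' : (0 : ℝ) < M := lt_of_le_of_lt (by positivity) hM
  have hM0 : 0 < M := by exact_mod_cast hM0'
  set δ : ℝ := d / 4 / M with hδ
  have hδ0 : 0 < δ := by positivity
  have hδM : δ * M = d / 4 := div_mul_cancel₀ _ hM0'.ne'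
  have hδμ : δ ≤ μ := by
    rw [hδ, div_le_iff₀ hM0']
    rw [div_lt_iff₀ hμ] at hM
    linarith
  set t : ℝ := Real.log (2 * N) with ht
  have ht0 : 0 < t := Real.log_pos (by linarith)
  set q : ℝ := Real.exp (-(t / M)) with hq
  have hq0 : 0 < q := Real.exp_pos _
  have hq1 : q < 1 := Real.exp_lt_one_iff.mpr (by have := div_pos ht0 hM0'; linarith)
  have hqM : q ^ M = 1 / (2 * N) := by
    rw [hq, ← Real.exp_nat_mul, mul_neg, mul_div_cancel₀ _ hM0'.ne', Real.exp_neg, ht,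
      Real.exp_log (by linarith), one_div]
  have h1q : 1 - q ≤ t / M := by
    have := Real.add_one_le_exp (-(t / M))
    linarith
  set light : List V := (H.verts.filter fun v =>
    2 * (outBall H (nonnegWt w) v (d / 4)).card ≤ H.verts.card ∨
    2 * (inBall H (nonnegWt w) v (d / 4)).card ≤ H.verts.card).toList with hlight
  have hradius : ∀ j < M, δ * j ≤ d / 4 := by
    intro j hj
    rw [← hδM]
    gcongr
  have hcarver : ∀ v ∈ light, ∃ p src dst, IsCarver w H (ENNReal.ofReal (2 * (1 - q) / δ))
      (ENNReal.ofReal (q ^ M / (1 - q ^ M))) v p src dst := by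
    intro v hv
    rw [hlight, Finset.mem_toList, Finset.mem_filter] at hv
    obtain ⟨hvH, hv | hv⟩ := hv
    · obtain ⟨p, hp⟩ := exists_isCarver (w := w) (H := H) (v := v) hq0 hq1 hδ0 hM0
        (ball := fun j => outBall H (nonnegWt w) v (δ * j)) (src := Prod.fst) (dst := Prod.snd)
        (Or.inl ⟨rfl, rfl⟩) (fun i j hij => outBall_mono (by gcongr))
        (fun j => (hself v hvH _ (by positivity)).1)
        (fun j hj => le_trans (by gcongr; exact outBall_mono (hradius j hj)) hv)
        (fun e he hw => hδμ.trans (hμw e he hw))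
        (fun e he j m hm h => outBall_step he (by push_cast; linarith) h)
      exact ⟨p, _, _, hp⟩
    · obtain ⟨p, hp⟩ := exists_isCarver (w := w) (H := H) (v := v) hq0 hq1 hδ0 hM0
        (ball := fun j => inBall H (nonnegWt w) v (δ * j)) (src := Prod.snd) (dst := Prod.fst)
        (Or.inr ⟨rfl, rfl⟩) (fun i j hij => inBall_mono (by gcongr))
        (fun j => (hself v hvH _ (by positivity)).2)
        (fun j hj => le_trans (by gcongr; exact inBall_mono (hradius j hj)) hv)
        (fun e he hw => hδμ.trans (hμw e he hw))
        (fun e he j m hm h => inBall_step he (by push_cast; linarith) h)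
      exact ⟨p, _, _, hp⟩
  obtain ⟨law, h1, h2, h3⟩ := exists_carving light hcarver H.verts
  refine ⟨law, fun S hS e he => ⟨(h1 S hS e he).1, (h1 S hS e he).2.1⟩, hprogress _ ?_, ?_⟩
  · intro S hS v hv
    rcases h2 S hS _ (scc_verts_subset H S v) (stronglyConnectedOn_scc H S v) with h | h
    · left
      omega
    · right
      intro x hx
      have hxl : x ∉ light := fun hxl => h x hxl hx
      rw [hlight, Finset.mem_toList, Finset.mem_filter, not_and, not_or, not_le, not_le] at hxl
      exact hxl (scc_verts_subset _ _ _ hx)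
  · intro P hP hPd
    have hlen : (light.length : ℝ) ≤ N := by
      rw [hlight, Finset.length_toList]
      exact_mod_cast (Finset.card_filter_le _ _).trans hN
    have hε : (light.length : ℝ) * (q ^ M / (1 - q ^ M)) ≤ 1 := by
      have e1 : q ^ M / (1 - q ^ M) = 1 / (2 * N - 1) := by
        rw [hqM]
        have : (2 * N - 1 : ℝ) ≠ 0 := by linarith
        field_simp
      rw [e1, mul_one_div, div_le_one (by linarith)]
      linarith
    have hε0 : 0 ≤ q ^ M / (1 - q ^ M) :=
      div_nonneg (by positivity) (by linarith [pow_le_one₀ (n := M) hq0.le hq1.le])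
    have hΛ : 2 * (1 - q) / δ ≤ 8 * t / d := by
      rw [div_le_div_iff₀ hδ0 hd]
      have : δ = d / 4 / M := hδ
      calc 2 * (1 - q) * d ≤ 2 * (t / M) * d := by gcongr
        _ = 8 * t * δ := by rw [this]; ring
    have hedge : ∀ e ∈ walkEdges P, ∑ S, law S * (if e ∈ S then 1 else 0) ≤
        ENNReal.ofReal (16 * t / d * nonnegWt w e.1 e.2) := by
      intro e he
      refine (h3 e (hP.3 e he)).trans ?_
      have hℓ0 : 0 ≤ nonnegWt w e.1 e.2 := le_max_right _ _
      have hΛ0 : 0 ≤ 2 * (1 - q) / δ := div_nonneg (by linarith) hδ0.le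
      rw [← ENNReal.ofReal_natCast light.length, ← ENNReal.ofReal_one,
        ← ENNReal.ofReal_mul hℓ0, ← ENNReal.ofReal_mul (Nat.cast_nonneg _),
        ← ENNReal.ofReal_add (by norm_num) (by positivity), ← ENNReal.ofReal_mul (by positivity)]
      refine ENNReal.ofReal_le_ofReal ?_
      calc _ ≤ nonnegWt w e.1 e.2 * (8 * t / d) * (1 + 1) := by gcongr
        _ = 16 * t / d * nonnegWt w e.1 e.2 := by ring
    have ht2 : t ≤ 2 * Real.log N := by
      rw [ht, Real.log_mul (by norm_num) (by linarith)]
      have := Real.log_le_log (by norm_num) hN2'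
      linarith
    rw [sum_mul_hits]
    calc _ ≤ ((walkEdges P).map fun e =>
          ENNReal.ofReal (16 * t / d * nonnegWt w e.1 e.2)).sum := List.sum_le_sum hedge
      _ = ENNReal.ofReal (16 * t / d * walkWeight (nonnegWt w) P) := by
        rw [← walkWeight_mul_left]
        unfold walkWeight
        induction walkEdges P with
        | nil => simp
        | cons e l ih =>
          rw [List.map_cons, List.sum_cons, ih, List.map_cons, List.sum_cons,
            ENNReal.ofReal_add]
          · exact mul_nonneg (by positivity) (le_max_right _ _)
          · refine List.sum_nonneg ?_
            simp only [List.mem_map]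
            rintro _ ⟨e, -, rfl⟩
            exact mul_nonneg (by positivity) (le_max_right _ _)
      _ ≤ ENNReal.ofReal (32 * Real.log N) := by
        refine ENNReal.ofReal_le_ofReal ?_
        calc 16 * t / d * walkWeight (nonnegWt w) P ≤ 16 * t / d * d := by gcongr
          _ = 16 * t := div_mul_cancel₀ _ hd.ne'
          _ ≤ 32 * Real.log N := by linarith

/-! ### Expected running time -/

theorem log_log_three_pos : 0 < Real.log (Real.log 3) := by
  refine Real.log_pos ?_
  rw [Real.lt_log_iff_exp_lt (by norm_num)]
  linarith [Real.exp_one_lt_d9]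

theorem log_log_natLog_le {n : ℕ} (hn : 3 ≤ n) :
    (Nat.log 2 (Nat.log 2 (n + 1)) : ℝ) ≤ 4 + 2 * Real.log (Real.log n) := by
  have hlog2 : (1 / 2 : ℝ) < Real.log 2 := by linarith [Real.log_two_gt_d9]
  have hlog2' : Real.log 2 < 1 := by linarith [Real.log_two_lt_d9]
  have hnat : ∀ x : ℕ, x ≠ 0 → (Nat.log 2 x : ℝ) * Real.log 2 ≤ Real.log x := by
    intro x hx
    rw [← Real.log_pow]
    refine Real.log_le_log (by positivity) ?_
    exact_mod_cast Nat.pow_log_le_self 2 hx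
  have hn' : (3 : ℝ) ≤ n := by exact_mod_cast hn
  have hlogn : 0 < Real.log n := Real.log_pos (by linarith)
  set a := Nat.log 2 (n + 1) with ha
  have ha0 : 0 < a := Nat.log_pos (by norm_num) (by omega)
  have ha0' : (0 : ℝ) < a := by exact_mod_cast ha0
  have h1 : (a : ℝ) * Real.log 2 ≤ 2 * Real.log n := by
    refine (hnat (n + 1) (by omega)).trans ?_
    rw [← Nat.cast_two, ← Real.log_pow]
    refine Real.log_le_log (by positivity) ?_
    push_cast
    nlinarith
  have h2 : (a : ℝ) ≤ 4 * Real.log n := by nlinarith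
  have h3 : Real.log a ≤ Real.log 4 + Real.log (Real.log n) := by
    rw [← Real.log_mul (by norm_num) hlogn.ne']
    exact Real.log_le_log ha0' h2
  have h4 : Real.log 4 = 2 * Real.log 2 := by
    rw [show (4 : ℝ) = 2 ^ 2 by norm_num, Real.log_pow]
    norm_num
  have h5 := hnat a ha0.ne'
  have h6 : (0 : ℝ) ≤ Nat.log 2 a := Nat.cast_nonneg _
  nlinarith

/-- One iteration takes time `O(m + n log log n)`.  For `n = 2` the second summand is negative,
but there are at least two edges. -/
theorem exists_iterCost_le : ∃ K : ℝ, 0 < K ∧ ∀ {V : Type u} (H : FinDigraph V),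
    2 ≤ H.edges.card → (iterCost (withSource H) : ℝ) ≤
      K * (H.edges.card + H.verts.card * Real.log (Real.log H.verts.card)) := by
  have hL3 := log_log_three_pos
  refine ⟨20 + 15 / Real.log (Real.log 3), by positivity, fun {V} H hm => ?_⟩
  have hmn : H.edges.card ≤ H.verts.card * H.verts.card := by
    rw [← Finset.card_product]
    exact Finset.card_le_card fun e he =>
      Finset.mem_product.mpr ⟨H.fst_mem e he, H.snd_mem e he⟩
  have hE := card_withSource_edges_le H
  have hE' : ((withSource H).edges.card : ℝ) ≤ H.verts.card + H.edges.card := by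
    exact_mod_cast hE
  simp only [iterCost, extractCost, card_withSource_verts]
  push_cast
  set n := H.verts.card with hn
  set m := H.edges.card with hm'
  have hm2 : (2 : ℝ) ≤ m := by exact_mod_cast hm
  have hn2 : 2 ≤ n := by
    by_contra hcon
    have : n * n ≤ 1 := by interval_cases n <;> omega
    omega
  rcases hn2.eq_or_lt with h2 | h3
  · rw [← h2] at hE' ⊢
    have e1 : Nat.log 2 (Nat.log 2 (2 + 1)) = 0 := by decide +kernel
    have h4 : -(0.45 : ℝ) ≤ Real.log (Real.log 2) := by
      have h5 := Real.one_sub_inv_le_log_of_pos (Real.log_pos one_lt_two)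
      have h6 : (Real.log 2)⁻¹ ≤ 1.45 := by
        rw [inv_le_comm₀ (Real.log_pos one_lt_two) (by norm_num)]
        have := Real.log_two_gt_d9
        norm_num at this ⊢
        linarith
      linarith
    rw [e1]
    push_cast
    push_cast at hE'
    have h7 : 0 ≤ 15 / Real.log (Real.log 3) := by positivity
    have h8 : (m : ℝ) / 2 ≤ m + 2 * Real.log (Real.log 2) := by linarith
    calc _ ≤ 20 * ((m : ℝ) / 2) := by linarith
      _ ≤ (20 + 15 / Real.log (Real.log 3)) * (m + 2 * Real.log (Real.log 2)) := by
        gcongr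
        linarith
  · have hn3 : (3 : ℝ) ≤ n := by exact_mod_cast h3
    have hℓ := log_log_natLog_le h3
    set ℓ := Nat.log 2 (Nat.log 2 (n + 1)) with hℓ'
    set LL := Real.log (Real.log n) with hLL
    have hLL3 : Real.log (Real.log 3) ≤ LL := by
      refine Real.log_le_log (Real.log_pos (by norm_num)) ?_
      exact Real.log_le_log (by norm_num) hn3
    have hLL0 : 0 < LL := hL3.trans_le hLL3
    have h9 : (n : ℝ) ≤ 1 / Real.log (Real.log 3) * (n * LL) := by
      rw [one_div, inv_mul_eq_div, le_div_iff₀ hL3]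
      gcongr
    have h10 : ((n : ℝ) + 1) * ℓ ≤ 2 * n * (4 + 2 * LL) := by
      gcongr
      linarith
    have h11 : 0 ≤ 1 / Real.log (Real.log 3) * m := by positivity
    have h12 : 0 ≤ (n : ℝ) * LL := by positivity
    have e2 : (20 + 15 / Real.log (Real.log 3)) * (m + n * LL) =
        20 * m + 20 * (n * LL) + 15 * (1 / Real.log (Real.log 3) * m) +
          15 * (1 / Real.log (Real.log 3) * (n * LL)) := by ring
    rw [e2]
    linarith

/-- If a resource is bounded by `a (hits + b)` whenever it is used, its expectation is
`O(a log N)`. -/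
theorem sum_mul_resource_le [Fintype V] {law : PMF (Finset (V × V))} {Q : List V} {c b : ℝ}
    {N : ℕ} (hN : 2 ≤ N) (hb : 0 ≤ b)
    (hQ : ∑ S, law S * (hits S Q : ENNReal) ≤ ENNReal.ofReal (c * Real.log N))
    {a : ℝ} (ha : 0 ≤ a) {f : Finset (V × V) → ENNReal}
    (hf : ∀ S ∈ law.support, f S ≤ ENNReal.ofReal a * (hits S Q + ENNReal.ofReal b)) :
    ∑ S, law S * f S ≤ ENNReal.ofReal (a * ((|c| + b / Real.log 2) * Real.log N)) := by
  have hlog2 : 0 < Real.log 2 := Real.log_pos one_lt_two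
  have hN' : (2 : ℝ) ≤ N := by exact_mod_cast hN
  have hlogN : Real.log 2 ≤ Real.log N := Real.log_le_log (by norm_num) hN'
  calc _ ≤ ∑ S, law S * (ENNReal.ofReal a * (hits S Q + ENNReal.ofReal b)) :=
        law.sum_mul_le_sum_mul hf
    _ = ENNReal.ofReal a * (∑ S, law S * (hits S Q : ENNReal) + ENNReal.ofReal b) := by
        rw [mul_add, Finset.mul_sum]
        simp only [mul_add, Finset.sum_add_distrib]
        congr 1
        · exact Finset.sum_congr rfl fun S _ => by ring
        · rw [← Finset.sum_mul, law.sum_eq_one, one_mul]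
    _ ≤ ENNReal.ofReal a *
          (ENNReal.ofReal (|c| * Real.log N) + ENNReal.ofReal (b / Real.log 2 * Real.log N)) := by
        gcongr
        · refine hQ.trans (ENNReal.ofReal_le_ofReal ?_)
          gcongr
          exact le_abs_self c
        · rw [div_mul_eq_mul_div, le_div_iff₀ hlog2]
          gcongr
    _ = _ := by
        rw [← ENNReal.ofReal_add (by positivity) (by positivity), ← ENNReal.ofReal_mul ha,
          add_mul]

theorem IsNegCycle.two_le_card_edges {H : FinDigraph V} {w : V → V → ℝ} {P : List V}
    (hP : IsNegCycle H w P)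
    (hnp : ¬ ∃ P, IsNegCycle H w P ∧ ∀ e ∈ walkEdges P, w e.1 e.2 ≤ 0) : 2 ≤ H.edges.card := by
  obtain ⟨e, he, hpos⟩ : ∃ e ∈ walkEdges P, 0 < w e.1 e.2 := by
    by_contra hcon
    push Not at hcon
    exact hnp ⟨P, hP, hcon⟩
  obtain ⟨e', he', hneg⟩ : ∃ e ∈ walkEdges P, w e.1 e.2 < 0 := by
    by_contra hcon
    push Not at hcon
    exact absurd (walkWeight_nonneg hcon) (not_le.mpr hP.2)
  refine Finset.one_lt_card.mpr ⟨e, hP.1.1.3 e he, e', hP.1.1.3 e' he', ?_⟩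
  rintro rfl
  linarith

theorem ifReached_le {caught : Prop} {φ? : Option (V → ℝ)} {resource : (V → ℝ) → ENNReal}
    {b : ENNReal} (h : ¬ caught → ∀ ψ, φ? = some ψ → resource ψ ≤ b) :
    ifReached caught φ? resource ≤ b := by
  unfold ifReached
  split_ifs with hc
  · exact zero_le
  · cases φ? with
    | none => exact zero_le
    | some ψ => exact h hc ψ rfl

end

theorem mainTheorem3 :
    -- random edge sets with the guarantees of `Decompose` exist
    (∀ κ : ℝ, 0 < κ → ∃ c : ℝ, ∀ (V : Type u) [Fintype V] (w : V → V → ℝ) (H : FinDigraph V)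
      (d : ℝ) (N : ℕ), 0 < d → H.verts.card ≤ N →
      ∃ law : PMF (Finset (V × V)), IsDecomposition c κ N w H d law) ∧
    -- and for all of them
    (∀ c : ℝ, ∃ C : ℝ, 0 < C ∧
      ∀ (κ : ℝ) (V : Type u) [Fintype V] (E : Finset (V × V)) (wG : V → V → ℤ) (W : ℝ)
        (D : FinDigraph V → ℝ → PMF (Finset (V × V))) (σ : Outcome V) (H : FinDigraph V) (d : ℝ)
        (φ : Finset (V × V) → Option (V → ℝ)),
      0 < W →
      (∀ e ∈ E, -W ≤ (wG e.1 e.2 : ℝ)) →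
      (∀ (K : FinDigraph V) (r : ℝ), K.edges ⊆ E → 0 < r →
        IsDecomposition c κ (Fintype.card V) (scaledWt wG W) K r (D K r)) →
      (∀ (K : FinDigraph V) (r : ℝ), σ (K, r) ∈ (D K r).support) →
      -- `(H, d)` is a non-leaf node, and `H` contains a negative-weight cycle
      IsInternalNode E W σ H d →
      (∃ P, IsNegCycle H (scaledWt wG W) P) →
      -- if `BellmanFordDijkstra` is called when `S` is removed from `H`, then with a potential
      -- for which the remaining edges are non-negative
      (∀ S ψ, φ S = some ψ → ∀ e ∈ H.edges \ S, 0 ≤ reweight (scaledWt wG W) ψ e.1 e.2) →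
      -- expected running time
      (∑ S : Finset (V × V), D H d S *
          ifReached (CaughtAtLeaf E (scaledWt wG W) W (Function.update σ (H, d) S)) (φ S)
            (fun ψ => bfdTime H (scaledWt wG W) ψ d)) ≤
        ENNReal.ofReal (C * ((H.edges.card + H.verts.card * Real.log (Real.log H.verts.card)) *
          Real.log (Fintype.card V))) ∧
      -- expected number of iterations
      (∑ S : Finset (V × V), D H d S *
          ifReached (CaughtAtLeaf E (scaledWt wG W) W (Function.update σ (H, d) S)) (φ S)
            (fun ψ => bfdIterations H (scaledWt wG W) ψ d)) ≤
        ENNReal.ofReal (C * Real.log (Fintype.card V)) ∧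
      ∀ S ∈ (D H d).support,
        -- a negative cycle without positive edges is caught at a leaf
        ((∃ P, IsNegCycle H (scaledWt wG W) P ∧
            ∀ e ∈ walkEdges P, scaledWt wG W e.1 e.2 ≤ 0) →
          CaughtAtLeaf E (scaledWt wG W) W (Function.update σ (H, d) S)) ∧
        -- every negative edge in a leaf yields a negative cycle of `G`
        (AllProgress E (scaledWt wG W) W (Function.update σ (H, d) S) →
          ∀ K, IsLeaf E W (Function.update σ (H, d) S) K →
            ∀ e ∈ K.edges, scaledWt wG W e.1 e.2 < 0 →
              ClosesToNegCycle E wG W e.1 e.2 [e.1, e.2]) ∧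
        -- otherwise `BellmanFordDijkstra` stops by finding a path that yields a negative cycle
        (¬ CaughtAtLeaf E (scaledWt wG W) W (Function.update σ (H, d) S) →
          ∀ ψ, φ S = some ψ →
          ∃ (k : ℕ) (u v : V) (l : BFDLabel (Option V)),
            (bfdRun H (scaledWt wG W) ψ d k).status = BFDStatus.found (some v) ∧
            (bfdRun H (scaledWt wG W) ψ d k).label (some v) = some l ∧
            IsWalkFromTo H u v l.path ∧
            d < walkWeight (nonnegWt (scaledWt wG W)) l.path ∧
            ((∀ x ∈ H.verts, ψ x ≤ 0) →
              walkWeight (scaledWt wG W) l.path ≤ 0 ∧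
              (d < rootParam V W →
                AllProgress E (scaledWt wG W) W (Function.update σ (H, d) S) →
                ClosesToNegCycle E wG W u v l.path) ∧
              (d = rootParam V W →
                ∃ P, P <:+: l.path ∧ IsNegCycle H (scaledWt wG W) P ∧
                  IsNegCycle (rootGraph E) (fun a b => (wG a b : ℝ)) P)))) := by
  refine ⟨fun κ _ => ⟨32, fun V _ w H d N hd hN => exists_isDecomposition w H hd hN⟩,
    fun c => ?_⟩
  obtain ⟨K, hK0, hK⟩ := exists_iterCost_le.{u}
  have hlog2 : 0 < Real.log 2 := Real.log_pos one_lt_two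
  set C₀ : ℝ := |c| + 5 / Real.log 2 with hC₀
  have hC₀pos : 0 < C₀ := by positivity
  refine ⟨(1 + K) * C₀, by positivity, ?_⟩
  intro κ V _ E wG W D σ H d φ hW hE hD hσ hH hneg hφ
  set w := scaledWt wG W with hw
  have hsub := hH.edges_subset
  have hne : H.verts.Nonempty := by
    obtain ⟨P, hP⟩ := hneg
    obtain ⟨a, t, rfl⟩ := List.exists_cons_of_ne_nil hP.1.1.1
    exact ⟨a, hP.1.1.2 a (by simp)⟩
  have hd := hH.param_pos hW hne
  -- from now on, trees are built with the outcome `S` of the call at `(H, d)`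
  have hcaught : ∀ S ∈ (D H d).support,
      (∃ P, IsNegCycle H w P ∧ ∀ e ∈ walkEdges P, w e.1 e.2 ≤ 0) →
      CaughtAtLeaf E w W (Function.update σ (H, d) S) := by
    intro S hS
    refine caughtAtLeaf_of_isNegCycle hW (fun K r hK hKne e he => ?_) (hH.update hW S)
    have hmem : Function.update σ (H, d) S (K, r) ∈ (D K r).support := by
      by_cases heq : (K, r) = (H, d)
      · obtain ⟨rfl, rfl⟩ := Prod.mk.inj heq
        simpa using hS
      · rw [Function.update_of_ne heq]
        exact hσ K r
    exact ((hD K r hK.edges_subset (hK.param_pos hW hKne)).positive _ hmem e he).2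
  by_cases hnp : ∃ P, IsNegCycle H w P ∧ ∀ e ∈ walkEdges P, w e.1 e.2 ≤ 0
  · -- the node is never processed
    have hzero : ∀ resource : (V → ℝ) → ENNReal, ∑ S : Finset (V × V), D H d S *
        ifReached (CaughtAtLeaf E w W (Function.update σ (H, d) S)) (φ S) resource = 0 := by
      intro resource
      refine Finset.sum_eq_zero fun S _ => ?_
      by_cases hS : S ∈ (D H d).support
      · simp [ifReached, hcaught S hS hnp]
      · rw [PMF.mem_support_iff, not_not] at hS
        simp [hS]
    refine ⟨by rw [hzero]; exact zero_le, by rw [hzero]; exact zero_le, fun S hS =>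
      ⟨hcaught S hS, fun hprog K' hK' e he => closesToNegCycle_of_leaf hW hprog hK' he,
        fun hnc => absurd (hcaught S hS hnp) hnc⟩⟩
  obtain ⟨x, y, u, Q, hxy, hQ, hQd, himp⟩ := exists_improving_edge hd.le hnp hneg
  have hrun := fun S ψ (hψ : φ S = some ψ) => bfdRun_found hd (hφ S ψ hψ) hneg hxy hQ himp
  have hm2 : 2 ≤ H.edges.card := hneg.elim fun P hP => hP.two_le_card_edges hnp
  have hcost := hK H hm2
  set A : ℝ := H.edges.card + H.verts.card * Real.log (Real.log H.verts.card) with hA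
  have hA0 : 0 ≤ A := nonneg_of_mul_nonneg_right ((Nat.cast_nonneg _).trans hcost) hK0
  have hn2 : 2 ≤ Fintype.card V := by
    by_contra hcon
    have h1 : H.verts.card ≤ 1 := (Finset.card_le_univ _).trans (by omega)
    have h2 : H.edges.card ≤ H.verts.card * H.verts.card := by
      rw [← Finset.card_product]
      exact Finset.card_le_card fun e he =>
        Finset.mem_product.mpr ⟨H.fst_mem e he, H.snd_mem e he⟩
    nlinarith
  have hlogn : 0 ≤ Real.log (Fintype.card V) := Real.log_natCast_nonneg _
  have hsparse := (hD H d hsub hd).sparse Q hQ.1 hQd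
  refine ⟨?_, ?_, fun S hS => ⟨hcaught S hS,
    fun hprog K' hK' e he => closesToNegCycle_of_leaf hW hprog hK' he, ?_⟩⟩
  · refine (sum_mul_resource_le hn2 (b := 5) (by norm_num) hsparse (a := K * A) (by positivity)
      fun S _ => ifReached_le fun _ ψ hψ => iSup_le fun k => ?_).trans
      (ENNReal.ofReal_le_ofReal ?_)
    · have h1 := (hrun S ψ hψ).2.1 k
      have h2 : (withSource H).verts.card ≤ iterCost (withSource H) := by
        rw [iterCost]; omega
      have h3 : (bfdRun H w ψ d k).cost ≤ iterCost (withSource H) * (hits S Q + 5) := by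
        refine h1.trans ?_
        nlinarith
      have h4 : (iterCost (withSource H) : ENNReal) ≤ ENNReal.ofReal (K * A) := by
        rw [← ENNReal.ofReal_natCast]
        exact ENNReal.ofReal_le_ofReal hcost
      calc ((bfdRun H w ψ d k).cost : ENNReal)
          ≤ ((iterCost (withSource H) * (hits S Q + 5) : ℕ) : ENNReal) := by exact_mod_cast h3
        _ = (iterCost (withSource H) : ENNReal) * (hits S Q + ENNReal.ofReal 5) := by
          push_cast
          rw [ENNReal.ofReal_ofNat]
        _ ≤ _ := by gcongr
    · have h5 : 0 ≤ A * Real.log (Fintype.card V) := by positivity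
      nlinarith [mul_nonneg hC₀pos.le h5]
  · refine (sum_mul_resource_le hn2 (b := 5) (by norm_num) hsparse (a := 1) (by norm_num)
      fun S _ => ifReached_le fun _ ψ hψ => iSup_le fun k => ?_).trans
      (ENNReal.ofReal_le_ofReal ?_)
    · have h1 : (bfdRun H w ψ d k).iter ≤ hits S Q + 5 :=
        ((hrun S ψ hψ).1 k).trans (by omega)
      rw [ENNReal.ofReal_one, one_mul, ENNReal.ofReal_ofNat]
      exact_mod_cast h1
    · nlinarith [mul_nonneg hK0.le (mul_nonneg hC₀pos.le hlogn)]
  · intro _ ψ hψ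
    obtain ⟨-, -, k, u', v', l, h1, h2, h3, h4, h5, h6⟩ := hrun S ψ hψ
    refine ⟨k, u', v', l, h1, h2, h3, h4, fun hψ0 => ⟨h5 hψ0, fun hroot hprog => ?_, ?_⟩⟩
    · exact closesToNegCycle_of_long_walk hE hW (hH.update hW S) hprog hroot h3 h4 (h5 hψ0)
    · rintro rfl
      exact exists_isNegCycle_of_long_walk hE hW hsub h3.1 h4 (h5 hψ0) h6
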